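/- Let $\mathcal S,\mathcal A$ be measurable spaces and consider a discounted constrained MDP with transition kernel $P$, initial distribution $\rho$, discount factor $\gamma\in(0,1)$, measurable reward $r_0:\mathcal S\times\mathcal A\to[0,1]$ and utilities $r_i:\mathcal S\times\mathcal A\to[-1,1]$, $i\in[m]$, $m\ge 1$. Let $\pi_\theta$, $\theta\in\mathbb R^d$, be stationary policies given by positive densities $\pi_\theta(a|s)$ with respect to a reference measure on $\mathcal A$. Let $V_i^\theta=\mathbb E\big[\sum_{t\ge0}\gamma^t r_i(s_t,a_t)\big]$, where $s_0\sim\rho$, $a_t\sim\pi_\theta(\cdot|s_t)$, $s_{t+1}\sim P(\cdot|s_t,a_t)$. Put $\Theta=\{\theta: V_i^\theta\ge0\ \forall i\in[m]\}$ and, for $\eta>0$, $B_\eta^\theta=V_0^\theta+\eta\sum_{i=1}^m\log V_i^\theta$. Assume that $\theta\mapsto\log\pi_\theta(a|s)$ is twice differentiable on $\mathbb R^d$ for all $(s,a)$, and that $\|\nabla_\theta\log\pi_\theta(a|s)\|\le M_g$ and $\|\nabla^2_\theta\log\pi_\theta(a|s)\|\le M_h$ for all $\theta\in\Theta$ and all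 $(s,a)$, where $M_g,M_h>0$. From $n$ independent trajectories $(s_t^j,a_t^j)_{t}$ under $\pi_\theta$, truncated at horizon $H$, form $$\hat V_i^\theta=\frac1n\sum_{j=1}^n\sum_{t=0}^{H-1}\gamma^t r_i(s_t^j,a_t^j),\qquad \hat\nabla V_i^\theta=\frac1n\sum_{j=1}^n\sum_{t=0}^{H-1}\sum_{t'=0}^{t}\gamma^t r_i(s_t^j,a_t^j)\,\nabla_\theta\log\pi_\theta(a_{t'}^j|s_{t'}^j),$$ $$\hat\nabla B_\eta^\theta=\hat\nabla V_0^\theta+\eta\sum_{i=1}^m\frac{\hat\nabla V_i^\theta}{\hat V_i^\theta}.$$ Then for every $m\ge1$ and $M_g>0$ there are thresholds $n_0(\gamma,\eta,\varepsilon,\delta,v)\in\mathbb N$ and $H_0(\gamma,\eta,\varepsilon,v)\in\mathbb N$, depending on nothing else (in particular not on $d$, the spaces, the MDP, the policies or $M_h$), with the following properties. (1) For all such MDPs and policies, all $\theta$ with $v:=\min_{i\in[m]}V_i^\theta>0$, and all $\eta>0$, $\varepsilon>0$, $\delta\in(0,1]$: the function $\theta'\mapsto B_\eta^{\theta'}$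 is differentiable at $\theta$, and for all $n\ge n_0(\gamma,\eta,\varepsilon,\delta,v)$ and $H\ge H_0(\gamma,\eta,\varepsilon,v)$, $$\mathbb P\big(\|\hat\nabla B_\eta^\theta-\nabla_\theta B_\eta^\theta\|\le\varepsilon\big)\ge1-\delta .$$ (2) $n_0=\mathcal O\big(\varepsilon^{-2}(1-\gamma)^{-6}v^{-4}\eta^2\ln(1/\delta)\big)$: for all $K$ and $\delta_0<1$ there is a constant $C$, depending only on $m,M_g,K,\delta_0$, such that $n_0\le C\,\varepsilon^{-2}(1-\gamma)^{-6}v^{-4}\eta^2\ln(1/\delta)$ whenever $\gamma\in(0,1)$, $\eta>0$, $0<\varepsilon\le K\eta$, $0<\delta\le\delta_0$, $0<v\le\frac1{1-\gamma}$ and $v^2\le K\eta$. (3) $H_0=\mathcal O\big(\ln\frac1{\varepsilon v}\big)$: for all $\gamma\in(0,1)$, $K$ and $q<1$ there is a constant $C$, depending only on $m,M_g,\gamma,K,q$, such that $H_0\le C\ln\frac1{\varepsilon v}$ whenever $0<\eta\le K$, $0<\varepsilon\le K$, $0<v\le\frac1{1-\gamma}$ and $\varepsilon v\le q$. -/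

import Mathlib

open MeasureTheory ProbabilityTheory

/-- An infinite-horizon discounted constrained Markov decision process with state space `S`,
action space `A` (arbitrary measurable spaces) and `m` constraints. Index `0` of `r` is the reward,
the indices `1, …, m` are the utilities. -/
structure CMDP (S A : Type*) [MeasurableSpace S] [MeasurableSpace A] (m : ℕ) where
  /-- transition dynamics `P(· | s, a)` -/
  P : Kernel (S × A) S
  isMarkov : IsMarkovKernel P
  /-- initial state distribution -/
  ρ : Measure S
  isProb : IsProbabilityMeasure ρ
  /-- reward and utilities -/
  r : Fin (m + 1) → S × A → ℝ
  measurable_r : ∀ i, Measurable (r i)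
  r_zero_mem : ∀ x, r 0 x ∈ Set.Icc (0 : ℝ) 1
  r_mem : ∀ i x, r i x ∈ Set.Icc (-1 : ℝ) 1
  /-- discount factor -/
  γ : ℝ
  γ_mem : γ ∈ Set.Ioo (0 : ℝ) 1

/-- A family of stationary stochastic policies `π_θ(a | s)`, `θ ∈ ℝ^d`. `dens θ s a` is the
density of `π_θ(· | s)` at `a` with respect to a reference measure `ν` on `A` (e.g. the counting
measure for discrete actions, Lebesgue measure for continuous ones). The density is positive,
so that `log π_θ(a | s)` makes sense. -/
structure PolicyFamily (S A : Type*) [MeasurableSpace S] [MeasurableSpace A] (d : ℕ) where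
  ν : Measure A
  sFinite : SFinite ν
  dens : EuclideanSpace ℝ (Fin d) → S → A → ℝ
  measurable_dens : ∀ θ, Measurable (Function.uncurry (dens θ))
  dens_pos : ∀ θ s a, 0 < dens θ s a
  lintegral_dens : ∀ θ s, ∫⁻ a, ENNReal.ofReal (dens θ s a) ∂ν = 1

attribute [instance] CMDP.isMarkov CMDP.isProb PolicyFamily.sFinite

noncomputable section

variable {S A : Type*} [MeasurableSpace S] [MeasurableSpace A] {m d : ℕ}

/-- The policy `π_θ` as a kernel `s ↦ π_θ(· | s)`. -/
def PolicyFamily.kernel (π : PolicyFamily S A d) (θ : EuclideanSpace ℝ (Fin d)) : Kernel S A :=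
  Kernel.withDensity (Kernel.const S π.ν) (fun s a => ENNReal.ofReal (π.dens θ s a))

instance PolicyFamily.isMarkovKernel_kernel (π : PolicyFamily S A d)
    (θ : EuclideanSpace ℝ (Fin d)) : IsMarkovKernel (π.kernel θ) := by
  refine ⟨fun s => ⟨?_⟩⟩
  have h : Measurable (Function.uncurry fun s a => ENNReal.ofReal (π.dens θ s a)) :=
    (π.measurable_dens θ).ennreal_ofReal
  rw [PolicyFamily.kernel, Kernel.withDensity_apply' _ h]
  simpa using π.lintegral_dens θ s

/-- `log π_θ(a | s)` as a function of `θ`. -/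
def PolicyFamily.logDens (π : PolicyFamily S A d) (x : S × A) (θ : EuclideanSpace ℝ (Fin d)) : ℝ :=
  Real.log (π.dens θ x.1 x.2)

/-- The score `∇_θ log π_θ(a | s)`. -/
def PolicyFamily.score (π : PolicyFamily S A d) (x : S × A) (θ : EuclideanSpace ℝ (Fin d)) :
    EuclideanSpace ℝ (Fin d) :=
  gradient (π.logDens x) θ

namespace CMDP

/-- One step of the state-action chain: `s' ∼ P(· | s, a)`, then `a' ∼ π_θ(· | s')`. -/
def stepKernel (M : CMDP S A m) (π : PolicyFamily S A d) (θ : EuclideanSpace ℝ (Fin d)) :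
    Kernel (S × A) (S × A) :=
  M.P.compProd (Kernel.prodMkLeft (S × A) (π.kernel θ))

instance (M : CMDP S A m) (π : PolicyFamily S A d) (θ : EuclideanSpace ℝ (Fin d)) :
    IsMarkovKernel (M.stepKernel π θ) := by
  unfold stepKernel; infer_instance

/-- The step kernel, seen as a kernel from the history up to time `t`. -/
def historyKernel (M : CMDP S A m) (π : PolicyFamily S A d) (θ : EuclideanSpace ℝ (Fin d))
    (t : ℕ) : Kernel (Finset.Iic t → S × A) (S × A) :=
  (M.stepKernel π θ).comap (fun h => h ⟨t, Finset.mem_Iic.2 le_rfl⟩) (measurable_pi_apply _)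

instance (M : CMDP S A m) (π : PolicyFamily S A d) (θ : EuclideanSpace ℝ (Fin d)) (t : ℕ) :
    IsMarkovKernel (M.historyKernel π θ t) := by
  unfold historyKernel; infer_instance

/-- The law of the trajectory `(s_0, a_0, s_1, a_1, …)` with `s_0 ∼ ρ`, `a_t ∼ π_θ(· | s_t)`,
`s_{t+1} ∼ P(· | s_t, a_t)`. -/
def trajLaw (M : CMDP S A m) (π : PolicyFamily S A d) (θ : EuclideanSpace ℝ (Fin d)) :
    Measure (ℕ → S × A) :=
  Kernel.trajMeasure (X := fun _ => S × A) (M.ρ.compProd (π.kernel θ)) (M.historyKernel π θ)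

instance (M : CMDP S A m) (π : PolicyFamily S A d) (θ : EuclideanSpace ℝ (Fin d)) :
    IsProbabilityMeasure (M.trajLaw π θ) := by
  unfold trajLaw; infer_instance

/-- The value function `V_i^θ(ρ)`. -/
def value (M : CMDP S A m) (π : PolicyFamily S A d) (i : Fin (m + 1))
    (θ : EuclideanSpace ℝ (Fin d)) : ℝ :=
  ∫ τ, ∑' t : ℕ, M.γ ^ t * M.r i (τ t) ∂(M.trajLaw π θ)

/-- The feasible set `Θ`. -/
def feasible (M : CMDP S A m) (π : PolicyFamily S A d) : Set (EuclideanSpace ℝ (Fin d)) :=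
  {θ | ∀ i : Fin m, 0 ≤ M.value π i.succ θ}

/-- `min_{i ∈ [m]} V_i^θ(ρ)` (used for `m ≥ 1` only). -/
def minValue (M : CMDP S A m) (π : PolicyFamily S A d) (θ : EuclideanSpace ℝ (Fin d)) : ℝ :=
  ⨅ i : Fin m, M.value π i.succ θ

/-- The log barrier `B_η^θ(ρ)`. -/
def logBarrier (M : CMDP S A m) (π : PolicyFamily S A d) (η : ℝ)
    (θ : EuclideanSpace ℝ (Fin d)) : ℝ :=
  M.value π 0 θ + η * ∑ i : Fin m, Real.log (M.value π i.succ θ)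

/-- Bounded score derivatives: `θ ↦ log π_θ(a | s)` is twice differentiable, and on the feasible
set its gradient and its Hessian are bounded by `Mg` and `Mh`, uniformly in `(s, a)`. -/
def BoundedScore (M : CMDP S A m) (π : PolicyFamily S A d) (Mg Mh : ℝ) : Prop :=
  (∀ x, Differentiable ℝ (π.logDens x)) ∧ (∀ x, Differentiable ℝ (π.score x)) ∧
    ∀ θ ∈ M.feasible π, ∀ x, ‖π.score x θ‖ ≤ Mg ∧ ‖fderiv ℝ (π.score x) θ‖ ≤ Mh

/-- The joint law of `n` independent trajectories. -/
def batchLaw (M : CMDP S A m) (π : PolicyFamily S A d) (θ : EuclideanSpace ℝ (Fin d)) (n : ℕ) :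
    Measure (Fin n → ℕ → S × A) :=
  Measure.pi fun _ => M.trajLaw π θ

/-- The value estimator from the batch `ω`, whose trajectories are truncated at horizon `H`. -/
def valueEst (M : CMDP S A m) (H : ℕ) {n : ℕ} (i : Fin (m + 1)) (ω : Fin n → ℕ → S × A) : ℝ :=
  (n : ℝ)⁻¹ * ∑ j, ∑ t ∈ Finset.range H, M.γ ^ t * M.r i (ω j t)

/-- The GPOMDP gradient estimator. -/
def gradEst (M : CMDP S A m) (π : PolicyFamily S A d) (θ : EuclideanSpace ℝ (Fin d)) (H : ℕ)
    {n : ℕ} (i : Fin (m + 1)) (ω : Fin n → ℕ → S × A) : EuclideanSpace ℝ (Fin d) :=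
  (n : ℝ)⁻¹ • ∑ j, ∑ t ∈ Finset.range H, ∑ t' ∈ Finset.range (t + 1),
    (M.γ ^ t * M.r i (ω j t)) • π.score (ω j t') θ

/-- The plug-in estimator of the log-barrier gradient. -/
def logBarrierGradEst (M : CMDP S A m) (π : PolicyFamily S A d) (η : ℝ)
    (θ : EuclideanSpace ℝ (Fin d)) (H : ℕ) {n : ℕ} (ω : Fin n → ℕ → S × A) :
    EuclideanSpace ℝ (Fin d) :=
  M.gradEst π θ H 0 ω +
    η • ∑ i : Fin m, (M.valueEst H i.succ ω)⁻¹ • M.gradEst π θ H i.succ ω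

end CMDP

end

/-!
Reweighting a trajectory, truncated at time `T`, by its likelihood ratio moves the dependence of
`E_θ'[r_i(s_T, a_T)]` on `θ'` from the law into a weight whose logarithmic derivative at `θ` is the
sum of the scores up to time `T`. Differentiating term by term gives the policy gradient theorem.
Scheffé's lemma makes the values continuous at `θ`, so that strict feasibility, and with it the
score bound, persists near `θ` and dominates the differentiation.

The value and gradient estimators are then means of independent copies of truncated series dominated
by `γ ^ t` and `Mg (t + 1) γ ^ t`. Since `cosh ‖s + x‖ ≤ cosh ‖s‖ exp (‖x‖ ^ 2) + ⟪φ(s), x⟫` in any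
inner product space, `E cosh ‖∑ X_i‖ ≤ exp (∑ B_i ^ 2)` for independent centred `X_i` with
`‖X_i‖ ≤ B_i`; this Chernoff argument is free of the dimension. The truncation error decays like
`√γ ^ H`, because `γ ^ t ≤ √γ ^ H √γ ^ t` for `t ≥ H`.

If the values are at least `v` and are estimated to within `v / 2`, the quotients in the gradient of
the log barrier depend on the estimates in a Lipschitz way, which dictates accuracies of order
`ε v / η` for the gradients and `ε v ^ 2 / η` for the values.
-/

section DominatedSeries

variable {E : Type*} [NormedAddCommGroup E]

theorem norm_sum_range_sub_le_of_hasSum {f : ℕ → E} {s : E} {u : ℕ → ℝ} {W : ℝ}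
    (hf : HasSum f s) (hu : HasSum u W) (hfu : ∀ t, ‖f t‖ ≤ u t) (H : ℕ) :
    ‖∑ t ∈ Finset.range H, f t - s‖ ≤ W - ∑ t ∈ Finset.range H, u t := by
  rw [norm_sub_rev]
  exact ((hasSum_nat_add_iff' H).2 hf).norm_le_of_bounded ((hasSum_nat_add_iff' H).2 hu)
    fun t => hfu (t + H)

theorem hasSum_add_one_mul_pow {x : ℝ} (hx0 : 0 ≤ x) (hx1 : x < 1) :
    HasSum (fun t : ℕ => (t + 1) * x ^ t) ((1 - x)⁻¹ ^ 2) := by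
  have h := hasSum_choose_mul_geometric_of_norm_lt_one 1 (by rwa [Real.norm_of_nonneg hx0])
  simpa using h

theorem hasSum_integral_of_norm_le [NormedSpace ℝ E] [CompleteSpace E] {Ω : Type*}
    [MeasurableSpace Ω] {μ : Measure Ω} [IsFiniteMeasure μ] {f : ℕ → Ω → E} {u : ℕ → ℝ}
    (hf : ∀ t, AEStronglyMeasurable (f t) μ) (hu : Summable u) (hfu : ∀ t ω, ‖f t ω‖ ≤ u t) :
    HasSum (fun t => ∫ ω, f t ω ∂μ) (∫ ω, ∑' t, f t ω ∂μ) :=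
  hasSum_integral_of_dominated_convergence (fun t _ => u t) hf (fun t => .of_forall (hfu t))
    (.of_forall fun _ => hu) (integrable_const _)
    (.of_forall fun ω => (hu.of_norm_bounded fun t => hfu t ω).hasSum)

end DominatedSeries

section Concentration

open Real

theorem exp_sub_self_le_exp_sq (x : ℝ) : exp x - x ≤ exp (x ^ 2) := by
  have h_sq : x ^ 2 + 1 ≤ exp (x ^ 2) := add_one_le_exp (x ^ 2)
  rcases le_total |x| 1 with h | h
  · linarith [(abs_le.1 (abs_exp_sub_one_sub_id_le h)).2]
  rcases le_abs.1 h with hx | hx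
  · linarith [exp_le_exp.2 (show x ≤ x ^ 2 by nlinarith)]
  · nlinarith [exp_le_one_iff.2 (show x ≤ 0 by linarith)]

theorem monotoneOn_exp_sub_self : MonotoneOn (fun x : ℝ => exp x - x) (Set.Ici 0) := by
  intro x hx y _ hxy
  have hexp : exp y = exp x * exp (y - x) := by rw [← exp_add]; ring_nf
  have h := mul_le_mul_of_nonneg_left (add_one_le_exp (y - x)) (exp_pos x).le
  have h_one := mul_nonneg (sub_nonneg.2 (one_le_exp hx)) (sub_nonneg.2 hxy)
  change exp x - x ≤ exp y - y
  linarith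

theorem convexOn_cosh_sqrt : ConvexOn ℝ (Set.Ici 0) fun u : ℝ => cosh √u := by
  have hseries (u : ℝ) (hu : 0 ≤ u) :
      HasSum (fun k : ℕ => u ^ k / (2 * k).factorial) (cosh √u) := by
    simpa only [pow_mul, sq_sqrt hu] using hasSum_cosh √u
  refine ⟨convex_Ici 0, fun x hx y hy p q hp hq hpq => ?_⟩
  have hxy : 0 ≤ p • x + q • y := convex_Ici (0 : ℝ) hx hy hp hq hpq
  refine hasSum_le (fun k => ?_) (hseries _ hxy)
    (((hseries x hx).mul_left p).add ((hseries y hy).mul_left q))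
  rw [← mul_div_assoc, ← mul_div_assoc, ← add_div]
  gcongr
  exact (convexOn_pow k).2 hx hy hp hq hpq

theorem integrable_cosh_norm_of_norm_le {F Ω : Type*} [NormedAddCommGroup F]
    {mΩ : MeasurableSpace Ω} {μ : Measure Ω} [IsFiniteMeasure μ] {Y : Ω → F}
    (hY : AEStronglyMeasurable Y μ) {C : ℝ} (hC : ∀ ω, ‖Y ω‖ ≤ C) :
    Integrable (fun ω => cosh ‖Y ω‖) μ := by
  refine Integrable.of_bound (C := cosh C) (continuous_cosh.comp_aestronglyMeasurable hY.norm)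
    (Filter.Eventually.of_forall fun ω => ?_)
  rw [norm_of_nonneg (cosh_pos _).le, cosh_le_cosh, abs_of_nonneg (norm_nonneg _)]
  exact (hC ω).trans (le_abs_self C)

variable {E : Type*} [NormedAddCommGroup E] [InnerProductSpace ℝ E]

/- `‖s + x‖ ^ 2` is a convex combination of `(‖s‖ + ‖x‖) ^ 2` and `(‖s‖ - ‖x‖) ^ 2`, and
`u ↦ cosh √u` is convex. -/
theorem cosh_norm_add_le (s x : E) :
    cosh ‖s + x‖ ≤ cosh ‖s‖ * cosh ‖x‖ +
      sinh ‖s‖ / ‖s‖ * (sinh ‖x‖ / ‖x‖ * inner ℝ s x) := by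
  rcases eq_or_ne s 0 with rfl | hs
  · simp
  rcases eq_or_ne x 0 with rfl | hx
  · simp
  have hs' : 0 < ‖s‖ := norm_pos_iff.2 hs
  have hx' : 0 < ‖x‖ := norm_pos_iff.2 hx
  set c : ℝ := inner ℝ s x / (‖s‖ * ‖x‖) with hc
  have hc_abs := abs_le.1 (abs_real_inner_div_norm_mul_norm_le_one s x)
  have hinner : inner ℝ s x = c * (‖s‖ * ‖x‖) := by rw [hc]; field_simp
  have hconvex := convexOn_cosh_sqrt.2 (Set.mem_Ici.2 (sq_nonneg (‖s‖ + ‖x‖)))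
    (Set.mem_Ici.2 (sq_nonneg (‖s‖ - ‖x‖))) (show 0 ≤ (1 + c) / 2 by linarith [hc_abs.1])
    (show 0 ≤ (1 - c) / 2 by linarith [hc_abs.2]) (by ring)
  have hnorm : (1 + c) / 2 * (‖s‖ + ‖x‖) ^ 2 + (1 - c) / 2 * (‖s‖ - ‖x‖) ^ 2 =
      ‖s + x‖ ^ 2 := by
    rw [norm_add_sq_real, hinner]; ring
  simp only [smul_eq_mul, hnorm, sqrt_sq_eq_abs, cosh_abs, cosh_add, cosh_sub] at hconvex
  refine hconvex.trans_eq ?_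
  rw [hinner]
  field_simp
  ring

theorem sinh_div_self_mul_inner_le (s x : E) :
    sinh ‖x‖ / ‖x‖ * inner ℝ s x ≤ inner ℝ s x + ‖s‖ * (sinh ‖x‖ - ‖x‖) := by
  rcases eq_or_ne x 0 with rfl | hx
  · simp
  have hx' : 0 < ‖x‖ := norm_pos_iff.2 hx
  have hslope : 0 ≤ sinh ‖x‖ / ‖x‖ - 1 := by
    rw [sub_nonneg, one_le_div hx']; exact self_le_sinh_iff.2 hx'.le
  have h := mul_le_mul_of_nonneg_left (real_inner_le_norm s x) hslope
  have hcancel : (sinh ‖x‖ / ‖x‖ - 1) * (‖s‖ * ‖x‖) = ‖s‖ * (sinh ‖x‖ - ‖x‖) := by field_simp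
  linarith

theorem cosh_norm_add_le_of_norm_le {B : ℝ} (s : E) {x : E} (hx : ‖x‖ ≤ B) :
    cosh ‖s + x‖ ≤ cosh ‖s‖ * exp (B ^ 2) + sinh ‖s‖ / ‖s‖ * inner ℝ s x := by
  have hslope : 0 ≤ sinh ‖s‖ / ‖s‖ :=
    div_nonneg (sinh_nonneg_iff.2 (norm_nonneg s)) (norm_nonneg s)
  have hslope_mul : sinh ‖s‖ / ‖s‖ * ‖s‖ ≤ cosh ‖s‖ := by
    rw [div_mul_cancel_of_imp fun h => by rw [h, sinh_zero]]; exact (sinh_lt_cosh _).le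
  have hexcess : 0 ≤ sinh ‖x‖ - ‖x‖ := sub_nonneg.2 (self_le_sinh_iff.2 (norm_nonneg x))
  have hexp : cosh ‖x‖ + (sinh ‖x‖ - ‖x‖) ≤ exp (B ^ 2) := by
    have := (monotoneOn_exp_sub_self (norm_nonneg x) ((norm_nonneg x).trans hx) hx).trans
      (exp_sub_self_le_exp_sq B)
    simp only [← cosh_add_sinh ‖x‖] at this
    linarith
  calc cosh ‖s + x‖
      ≤ cosh ‖s‖ * cosh ‖x‖ + sinh ‖s‖ / ‖s‖ * (sinh ‖x‖ / ‖x‖ * inner ℝ s x) :=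
        cosh_norm_add_le s x
    _ ≤ cosh ‖s‖ * cosh ‖x‖ +
          sinh ‖s‖ / ‖s‖ * (inner ℝ s x + ‖s‖ * (sinh ‖x‖ - ‖x‖)) := by
        gcongr; exact sinh_div_self_mul_inner_le s x
    _ = cosh ‖s‖ * cosh ‖x‖ + sinh ‖s‖ / ‖s‖ * ‖s‖ * (sinh ‖x‖ - ‖x‖) +
          sinh ‖s‖ / ‖s‖ * inner ℝ s x := by ring
    _ ≤ cosh ‖s‖ * cosh ‖x‖ + cosh ‖s‖ * (sinh ‖x‖ - ‖x‖) +
          sinh ‖s‖ / ‖s‖ * inner ℝ s x := by gcongr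
    _ = cosh ‖s‖ * (cosh ‖x‖ + (sinh ‖x‖ - ‖x‖)) + sinh ‖s‖ / ‖s‖ * inner ℝ s x := by ring
    _ ≤ cosh ‖s‖ * exp (B ^ 2) + sinh ‖s‖ / ‖s‖ * inner ℝ s x := by
        gcongr

variable [CompleteSpace E] [MeasurableSpace E] [BorelSpace E] [SecondCountableTopology E]
  {Ω : Type*} {mΩ : MeasurableSpace Ω} {μ : Measure Ω} [IsProbabilityMeasure μ]

theorem integral_cosh_norm_add_le_of_indepFun {Y X : Ω → E} (hYX : IndepFun Y X μ)
    (hY : Measurable Y) (hX : Measurable X) {C B : ℝ} (hC : ∀ ω, ‖Y ω‖ ≤ C)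
    (hB : ∀ ω, ‖X ω‖ ≤ B) (h_mean : ∫ ω, X ω ∂μ = 0) :
    ∫ ω, cosh ‖Y ω + X ω‖ ∂μ ≤ (∫ ω, cosh ‖Y ω‖ ∂μ) * exp (B ^ 2) := by
  set φ : E → E := fun s => (sinh ‖s‖ / ‖s‖) • s
  have hφ : Measurable φ := by fun_prop
  have hφC (ω : Ω) : ‖φ (Y ω)‖ ≤ sinh C := by
    rw [norm_smul, norm_div, norm_norm,
      div_mul_cancel_of_imp fun h => by rw [h, sinh_zero, norm_zero],
      norm_of_nonneg (sinh_nonneg_iff.2 (norm_nonneg _))]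
    exact sinh_le_sinh.2 (hC ω)
  have hφ_int : Integrable (fun ω => φ (Y ω)) μ :=
    .of_bound (hφ.comp hY).aestronglyMeasurable _ (.of_forall hφC)
  have hX_int : Integrable X μ := .of_bound hX.aestronglyMeasurable B (.of_forall hB)
  have hindep : IndepFun (fun ω => φ (Y ω)) X μ := hYX.comp hφ measurable_id
  have hcross : ∫ ω, innerSL ℝ (φ (Y ω)) (X ω) ∂μ = 0 := by
    rw [hindep.integral_bilin hφ_int hX_int, h_mean, map_zero]
  have hcross_int := hindep.integrable_bilin hφ_int hX_int (innerSL ℝ)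
  have hY_int := integrable_cosh_norm_of_norm_le (μ := μ) hY.aestronglyMeasurable hC
  calc ∫ ω, cosh ‖Y ω + X ω‖ ∂μ
      ≤ ∫ ω, (cosh ‖Y ω‖ * exp (B ^ 2) + innerSL ℝ (φ (Y ω)) (X ω)) ∂μ := by
        refine integral_mono (integrable_cosh_norm_of_norm_le (C := C + B)
          (hY.add hX).aestronglyMeasurable fun ω => norm_add_le_of_le (hC ω) (hB ω))
          ((hY_int.mul_const _).add hcross_int) fun ω => ?_
        simpa [φ, real_inner_smul_left] using cosh_norm_add_le_of_norm_le (Y ω) (hB ω)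
    _ = (∫ ω, cosh ‖Y ω‖ ∂μ) * exp (B ^ 2) := by
        rw [integral_add (hY_int.mul_const _) hcross_int, hcross, add_zero, integral_mul_const]

section Sum

variable {ι : Type*} {X : ι → Ω → E} {B : ι → ℝ}

theorem integral_cosh_norm_sum_le (hindep : iIndepFun X μ) (hX : ∀ i, Measurable (X i))
    (hB : ∀ i ω, ‖X i ω‖ ≤ B i) (h_mean : ∀ i, ∫ ω, X i ω ∂μ = 0) (s : Finset ι) :
    ∫ ω, cosh ‖∑ i ∈ s, X i ω‖ ∂μ ≤ exp (∑ i ∈ s, B i ^ 2) := by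
  classical
  induction s using Finset.induction_on with
  | empty => simp
  | insert i s hi ih =>
    have hi_indep : IndepFun (fun ω => ∑ j ∈ s, X j ω) (X i) μ := by
      simpa only [Finset.sum_fn] using hindep.indepFun_finsetSum_of_notMem hX hi
    calc ∫ ω, cosh ‖∑ j ∈ insert i s, X j ω‖ ∂μ
        = ∫ ω, cosh ‖∑ j ∈ s, X j ω + X i ω‖ ∂μ := by
          simp only [Finset.sum_insert hi, add_comm]
      _ ≤ (∫ ω, cosh ‖∑ j ∈ s, X j ω‖ ∂μ) * exp (B i ^ 2) :=
          integral_cosh_norm_add_le_of_indepFun hi_indep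
            (Finset.measurable_sum _ fun j _ => hX j) (hX i)
            (fun ω => norm_sum_le_of_le _ fun j _ => hB j ω) (hB i) (h_mean i)
      _ ≤ exp (∑ j ∈ s, B j ^ 2) * exp (B i ^ 2) := by gcongr
      _ = exp (∑ j ∈ insert i s, B j ^ 2) := by
          rw [← exp_add, Finset.sum_insert hi, add_comm]

theorem measureReal_le_norm_sum_le (hindep : iIndepFun X μ) (hX : ∀ i, Measurable (X i))
    (hB : ∀ i ω, ‖X i ω‖ ≤ B i) (h_mean : ∀ i, ∫ ω, X i ω ∂μ = 0) (s : Finset ι)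
    {a : ℝ} (ha : 0 ≤ a) :
    μ.real {ω | a ≤ ‖∑ i ∈ s, X i ω‖} ≤ 2 * exp (-(a ^ 2 / (4 * ∑ i ∈ s, B i ^ 2))) := by
  set V : ℝ := ∑ i ∈ s, B i ^ 2
  -- `l` minimizes the Chernoff exponent `l ^ 2 * V - l * a`
  set l : ℝ := a / (2 * V) with hl
  have hl0 : 0 ≤ l := by positivity
  have hlX (i : ι) : Measurable fun ω => l • X i ω := (hX i).const_smul l
  have hlB (i : ι) (ω : Ω) : ‖l • X i ω‖ ≤ l * B i := by
    rw [norm_smul, norm_of_nonneg hl0]; gcongr; exact hB i ω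
  have hbound : ∫ ω, cosh ‖∑ i ∈ s, l • X i ω‖ ∂μ ≤ exp (l ^ 2 * V) := by
    have h := integral_cosh_norm_sum_le
      (hindep.comp (fun _ x => l • x) fun _ => measurable_const_smul l) hlX hlB
      (fun i => by simp only [Function.comp_def, integral_smul, h_mean, smul_zero]) s
    simpa only [mul_pow, ← Finset.mul_sum, Function.comp_apply] using h
  have hmarkov := mul_meas_ge_le_integral_of_nonneg (μ := μ) (.of_forall fun ω => (cosh_pos _).le)
    (integrable_cosh_norm_of_norm_le
      (Finset.measurable_sum s fun i _ => hlX i).aestronglyMeasurable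
      fun ω => norm_sum_le_of_le s fun i _ => hlB i ω) (exp (l * a) / 2)
  have hsub : {ω | a ≤ ‖∑ i ∈ s, X i ω‖} ⊆
      {ω | exp (l * a) / 2 ≤ cosh ‖∑ i ∈ s, l • X i ω‖} := by
    intro ω (hω : a ≤ ‖∑ i ∈ s, X i ω‖)
    rw [Set.mem_ofPred_eq, ← Finset.smul_sum, norm_smul, norm_of_nonneg hl0, cosh_eq]
    have : exp (l * a) ≤ exp (l * ‖∑ i ∈ s, X i ω‖) := by gcongr
    linarith [exp_pos (-(l * ‖∑ i ∈ s, X i ω‖))]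
  have hexponent : exp (l ^ 2 * V) = exp (l * a) * exp (-(a ^ 2 / (4 * V))) := by
    rcases eq_or_ne V 0 with h | h
    · simp [hl, h]
    · rw [← exp_add, hl]; congr 1; field_simp; ring
  have hmono := mul_le_mul_of_nonneg_left (measureReal_mono (μ := μ) hsub)
    (div_nonneg (exp_pos (l * a)).le zero_le_two)
  refine le_of_mul_le_mul_left (a := exp (l * a)) ?_ (exp_pos _)
  linarith

end Sum

section Mean

theorem measureReal_lt_norm_mean_sub_integral_le {X : Ω → E} (hX : Measurable X) {B : ℝ}
    (hB : ∀ ω, ‖X ω‖ ≤ B) (n : ℕ) {a : ℝ} (ha : 0 ≤ a) :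
    (Measure.pi fun _ : Fin n => μ).real
      {ω | a < ‖(n : ℝ)⁻¹ • ∑ j, X (ω j) - ∫ x, X x ∂μ‖} ≤
      2 * exp (-(n * a ^ 2 / (16 * B ^ 2))) := by
  rcases n.eq_zero_or_pos with rfl | hn
  · exact measureReal_le_one.trans (by simp)
  have hn' : (0 : ℝ) < n := by exact_mod_cast hn
  set e := ∫ x, X x ∂μ
  have hX_int : Integrable X μ := .of_bound hX.aestronglyMeasurable B (.of_forall hB)
  have he_le : ‖e‖ ≤ B := by
    simpa using norm_integral_le_of_norm_le_const (μ := μ) (.of_forall hB)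
  have hY : Measurable fun x => X x - e := hX.sub_const e
  have hY_mean : ∫ x, X x - e ∂μ = 0 := by
    rw [integral_sub hX_int (integrable_const _), integral_const, probReal_univ, one_smul, sub_self]
  have htail := measureReal_le_norm_sum_le (B := fun _ => 2 * B)
    (iIndepFun_pi (μ := fun _ : Fin n => μ) (X := fun _ x => X x - e) fun _ => hY.aemeasurable)
    (fun j => hY.comp (measurable_pi_apply j))
    (fun j ω => (norm_sub_le _ _).trans (by linarith [hB (ω j)]))
    (fun j => by
      rw [← hY_mean]
      exact (measurePreserving_eval (fun _ : Fin n => μ) j).hasLaw.integral_comp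
        hY.aestronglyMeasurable)
    Finset.univ (mul_nonneg hn'.le ha)
  have hsub : {ω : Fin n → Ω | a < ‖(n : ℝ)⁻¹ • ∑ j, X (ω j) - e‖} ⊆
      {ω | n * a ≤ ‖∑ j, (X (ω j) - e)‖} := by
    intro ω (hω : a < _)
    have hcenter : ∑ j, (X (ω j) - e) = (n : ℝ) • ((n : ℝ)⁻¹ • ∑ j, X (ω j) - e) := by
      rw [Finset.sum_sub_distrib, smul_sub, smul_inv_smul₀ hn'.ne', Finset.sum_const,
        Finset.card_univ, Fintype.card_fin, Nat.cast_smul_eq_nsmul]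
    rw [Set.mem_ofPred_eq, hcenter, norm_smul, norm_of_nonneg hn'.le]
    gcongr
  refine (measureReal_mono hsub).trans (htail.trans_eq ?_)
  rw [Finset.sum_const, Finset.card_univ, Fintype.card_fin, nsmul_eq_mul]
  congr 3
  field_simp
  ring

/- The truncation error is at most the tail `W - ∑ t < H, u t` of the dominating series; the
sampling error is controlled by the tail bound for means at level `a / 2`. -/
theorem measureReal_lt_norm_mean_truncated_series_sub_le {f : ℕ → Ω → E}
    (hf : ∀ t, Measurable (f t)) {u : ℕ → ℝ} {W : ℝ} (hu : HasSum u W) (hW : 0 < W)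
    (hfu : ∀ t ω, ‖f t ω‖ ≤ u t) {a p : ℝ} (ha : 0 < a) (hp : 0 < p) {n H : ℕ}
    (hn : 64 * (W / a) ^ 2 * log (2 / p) ≤ n) (hH : W - ∑ t ∈ Finset.range H, u t ≤ a / 2) :
    (Measure.pi fun _ : Fin n => μ).real {ω | a <
      ‖(n : ℝ)⁻¹ • ∑ j, ∑ t ∈ Finset.range H, f t (ω j) - ∫ x, ∑' t, f t x ∂μ‖} ≤ p := by
  set g : Ω → E := fun x => ∑ t ∈ Finset.range H, f t x
  have hg_meas : Measurable g := Finset.measurable_sum _ fun t _ => hf t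
  have hu_nonneg (t : ℕ) : 0 ≤ u t := by
    obtain ⟨ω⟩ := nonempty_of_isProbabilityMeasure μ
    exact (norm_nonneg _).trans (hfu t ω)
  have hgW (x : Ω) : ‖g x‖ ≤ W :=
    (norm_sum_le_of_le _ fun t _ => hfu t x).trans (sum_le_hasSum _ (fun t _ => hu_nonneg t) hu)
  have hbias : ‖∫ x, g x ∂μ - ∫ x, ∑' t, f t x ∂μ‖ ≤ a / 2 := by
    have hf_int (t : ℕ) : Integrable (f t) μ :=
      .of_bound (hf t).aestronglyMeasurable (u t) (.of_forall (hfu t))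
    rw [integral_finsetSum _ fun t _ => hf_int t]
    refine (norm_sum_range_sub_le_of_hasSum
      (hasSum_integral_of_norm_le (fun t => (hf t).aestronglyMeasurable) hu.summable hfu) hu
      (fun t => ?_) H).trans hH
    simpa using norm_integral_le_of_norm_le_const (μ := μ) (.of_forall (hfu t))
  have hsub : {ω : Fin n → Ω | a < ‖(n : ℝ)⁻¹ • ∑ j, g (ω j) - ∫ x, ∑' t, f t x ∂μ‖} ⊆
      {ω | a / 2 < ‖(n : ℝ)⁻¹ • ∑ j, g (ω j) - ∫ x, g x ∂μ‖} := by
    intro ω (hω : a < _)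
    have := norm_sub_le_norm_sub_add_norm_sub ((n : ℝ)⁻¹ • ∑ j, g (ω j)) (∫ x, g x ∂μ)
      (∫ x, ∑' t, f t x ∂μ)
    rw [Set.mem_ofPred_eq]
    linarith
  calc _ ≤ 2 * exp (-(n * (a / 2) ^ 2 / (16 * W ^ 2))) :=
        (measureReal_mono hsub).trans
          (measureReal_lt_norm_mean_sub_integral_le hg_meas hgW n (half_pos ha).le)
    _ ≤ 2 * exp (-log (2 / p)) := by
        gcongr
        rw [le_div_iff₀ (by positivity)]
        calc log (2 / p) * (16 * W ^ 2) = 64 * (W / a) ^ 2 * log (2 / p) * (a / 2) ^ 2 := by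
              field_simp; ring
          _ ≤ n * (a / 2) ^ 2 := by gcongr
    _ = p := by rw [exp_neg, exp_log (by positivity)]; field_simp

end Mean

end Concentration

section TrajectoryDensity

open Preorder

theorem prod_Iic_frestrictLe {X : ℕ → Type*} {R : Type*} [CommMonoid R]
    (f : (n : ℕ) → X n → R) (T : ℕ) (x : Π n, X n) :
    ∏ t : Finset.Iic T, f t (frestrictLe T x t) = ∏ t ∈ Finset.range (T + 1), f t (x t) := by
  rw [Nat.range_succ_eq_Iic]
  exact Finset.prod_coe_sort (Finset.Iic T) fun t => f t (x t)

variable {X : ℕ → Type*} [∀ n, MeasurableSpace (X n)]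

/-- The history up to time `T + 1` obtained by appending `y` to the history `h` up to time `T`. -/
def snocHistory (T : ℕ) (h : Π i : Finset.Iic T, X i) (y : X (T + 1)) :
    Π i : Finset.Iic (T + 1), X i :=
  IicProdIoc T (T + 1) (h, MeasurableEquiv.piSingleton T y)

theorem measurable_snocHistory (T : ℕ) :
    Measurable (Function.uncurry (snocHistory (X := X) T)) :=
  measurable_IicProdIoc.comp
    (measurable_fst.prodMk ((MeasurableEquiv.piSingleton T).measurable.comp measurable_snd))

theorem snocHistory_frestrictLe (T : ℕ) (x : Π n, X n) :
    snocHistory T (frestrictLe T x) (x (T + 1)) = frestrictLe (T + 1) x := by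
  refine funext fun i => ?_
  by_cases hi : (i : ℕ) ≤ T
  · simp [snocHistory, IicProdIoc_def, hi]
  · obtain ⟨i, h⟩ := i
    obtain rfl : i = T + 1 := by rw [Finset.mem_Iic] at h; lia
    simp [snocHistory, IicProdIoc_def, MeasurableEquiv.piSingleton]

section

variable {μ : Measure (X 0)} {κ : (n : ℕ) → Kernel (Π i : Finset.Iic n, X i) (X (n + 1))}
  [∀ n, IsMarkovKernel (κ n)]

theorem lintegral_frestrictLe_zero_trajMeasure {g : (Π i : Finset.Iic 0, X i) → ENNReal}
    (hg : Measurable g) :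
    ∫⁻ x, g (frestrictLe 0 x) ∂(Kernel.trajMeasure μ κ) =
      ∫⁻ y, g ((MeasurableEquiv.piUnique fun i : Finset.Iic 0 => X i).symm y) ∂μ := by
  have h_map : (Kernel.trajMeasure μ κ).map (frestrictLe 0) =
      μ.map (MeasurableEquiv.piUnique fun i : Finset.Iic 0 => X i).symm := by
    rw [Kernel.trajMeasure, Measure.map_comp _ _ (measurable_frestrictLe 0),
      Kernel.traj_map_frestrictLe, Kernel.partialTraj_self, Measure.id_comp]
    rfl
  rw [← lintegral_map hg (measurable_frestrictLe 0), h_map]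
  exact lintegral_map_equiv _ _

theorem lintegral_trajMeasure_succ [IsProbabilityMeasure μ] (T : ℕ)
    {F : (Π i : Finset.Iic T, X i) → X (T + 1) → ENNReal}
    (hF : Measurable (Function.uncurry F)) :
    ∫⁻ x, F (frestrictLe T x) (x (T + 1)) ∂(Kernel.trajMeasure μ κ) =
      ∫⁻ x, ∫⁻ y, F (frestrictLe T x) y ∂(κ T (frestrictLe T x)) ∂(Kernel.trajMeasure μ κ) := by
  have h := congrArg (fun P => ∫⁻ p, Function.uncurry F p ∂P)
    (Kernel.map_frestrictLe_trajMeasure_compProd_eq_map_trajMeasure (μ₀ := μ) (κ := κ) (a := T))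
  rw [Measure.lintegral_compProd hF, lintegral_map hF.lintegral_kernel_prod_right'
    (measurable_frestrictLe T), lintegral_map hF (by fun_prop)] at h
  exact h.symm

end

variable {μ ν : Measure (X 0)} [IsProbabilityMeasure μ] [IsProbabilityMeasure ν]
  {κ η : (n : ℕ) → Kernel (Π i : Finset.Iic n, X i) (X (n + 1))}
  [∀ n, IsMarkovKernel (κ n)] [∀ n, IsMarkovKernel (η n)] {ℓ : (n : ℕ) → X n → ENNReal}

theorem lintegral_frestrictLe_trajMeasure_of_withDensity (hℓ : ∀ n, Measurable (ℓ n))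
    (hν : ν = μ.withDensity (ℓ 0)) (hη : ∀ n h, η n h = (κ n h).withDensity (ℓ (n + 1)))
    (T : ℕ) {g : (Π i : Finset.Iic T, X i) → ENNReal} (hg : Measurable g) :
    ∫⁻ x, g (frestrictLe T x) ∂(Kernel.trajMeasure ν η) =
      ∫⁻ x, (∏ t ∈ Finset.range (T + 1), ℓ t (x t)) * g (frestrictLe T x)
        ∂(Kernel.trajMeasure μ κ) := by
  induction T with
  | zero =>
    have hℓ₀ : Measurable fun h : Π i : Finset.Iic 0, X i => ℓ 0 (h ⟨0, Finset.mem_Iic.2 le_rfl⟩) :=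
      (hℓ 0).comp (measurable_pi_apply _)
    have h_ratio := lintegral_frestrictLe_zero_trajMeasure (μ := μ) (κ := κ) (hℓ₀.mul hg)
    simp only [zero_add, Finset.prod_range_one]
    refine Eq.trans ?_ h_ratio.symm
    rw [lintegral_frestrictLe_zero_trajMeasure hg, hν]
    exact lintegral_withDensity_eq_lintegral_mul _ (hℓ 0) (hg.comp (MeasurableEquiv.measurable _))
  | succ T ih =>
    have hg_snoc : Measurable (Function.uncurry fun h y => g (snocHistory T h y)) :=
      hg.comp (measurable_snocHistory T)
    have hℓg : Measurable (Function.uncurry fun h y => ℓ (T + 1) y * g (snocHistory T h y)) :=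
      ((hℓ _).comp measurable_snd).mul hg_snoc
    simp only [← snocHistory_frestrictLe, Finset.prod_range_succ _ (T + 1),
      ← prod_Iic_frestrictLe, mul_assoc] at ih ⊢
    calc ∫⁻ x, g (snocHistory T (frestrictLe T x) (x (T + 1))) ∂(Kernel.trajMeasure ν η)
        = ∫⁻ x, ∫⁻ y, g (snocHistory T (frestrictLe T x) y) ∂(η T (frestrictLe T x))
            ∂(Kernel.trajMeasure ν η) := lintegral_trajMeasure_succ T hg_snoc
      _ = ∫⁻ x, ∫⁻ y, ℓ (T + 1) y * g (snocHistory T (frestrictLe T x) y)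
            ∂(κ T (frestrictLe T x)) ∂(Kernel.trajMeasure ν η) := by
          refine lintegral_congr fun x => ?_
          rw [hη, lintegral_withDensity_eq_lintegral_mul _ (hℓ _) hg_snoc.of_uncurry_left]
          rfl
      _ = ∫⁻ x, (∏ t : Finset.Iic T, ℓ t (frestrictLe T x t)) *
            ∫⁻ y, ℓ (T + 1) y * g (snocHistory T (frestrictLe T x) y)
            ∂(κ T (frestrictLe T x)) ∂(Kernel.trajMeasure μ κ) :=
          ih hℓg.lintegral_kernel_prod_right
      _ = ∫⁻ x, ∫⁻ y, (∏ t : Finset.Iic T, ℓ t (frestrictLe T x t)) *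
            (ℓ (T + 1) y * g (snocHistory T (frestrictLe T x) y))
            ∂(κ T (frestrictLe T x)) ∂(Kernel.trajMeasure μ κ) :=
          lintegral_congr fun x => (lintegral_const_mul _ hℓg.of_uncurry_left).symm
      _ = _ := (lintegral_trajMeasure_succ T (F := fun h y =>
            (∏ t : Finset.Iic T, ℓ t (h t)) * (ℓ (T + 1) y * g (snocHistory T h y)))
            (.mul (Finset.measurable_prod _ fun t _ =>
              (hℓ t).comp ((measurable_pi_apply t).comp measurable_fst)) hℓg)).symm

theorem map_frestrictLe_trajMeasure_of_withDensity (hℓ : ∀ n, Measurable (ℓ n))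
    (hν : ν = μ.withDensity (ℓ 0)) (hη : ∀ n h, η n h = (κ n h).withDensity (ℓ (n + 1)))
    (T : ℕ) :
    (Kernel.trajMeasure ν η).map (frestrictLe T) =
      ((Kernel.trajMeasure μ κ).withDensity
        fun x => ∏ t ∈ Finset.range (T + 1), ℓ t (x t)).map (frestrictLe T) := by
  have hL : Measurable fun x : Π n, X n => ∏ t ∈ Finset.range (T + 1), ℓ t (x t) :=
    Finset.measurable_prod _ fun t _ => (hℓ t).comp (measurable_pi_apply t)
  refine Measure.ext_of_lintegral _ fun g hg => ?_
  have hgT : Measurable fun x => g (frestrictLe T x) := hg.comp (measurable_frestrictLe T)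
  rw [lintegral_map hg (measurable_frestrictLe T), lintegral_map hg (measurable_frestrictLe T),
    lintegral_frestrictLe_trajMeasure_of_withDensity hℓ hν hη T hg,
    lintegral_withDensity_eq_lintegral_mul _ hL hgT]
  rfl

end TrajectoryDensity

noncomputable section

variable {S A : Type*} [MeasurableSpace S] [MeasurableSpace A] {m d : ℕ}

section LikelihoodRatio

namespace PolicyFamily

variable (π : PolicyFamily S A d) (θ θ' : EuclideanSpace ℝ (Fin d))

/-- The likelihood ratio `π_θ'(a | s) / π_θ(a | s)`. -/
def ratio (x : S × A) : ℝ :=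
  π.dens θ' x.1 x.2 / π.dens θ x.1 x.2

theorem ratio_pos (x : S × A) : 0 < π.ratio θ θ' x :=
  div_pos (π.dens_pos _ _ _) (π.dens_pos _ _ _)

theorem ratio_self (x : S × A) : π.ratio θ θ x = 1 :=
  div_self (π.dens_pos _ _ _).ne'

theorem ratio_eq_exp (x : S × A) :
    π.ratio θ θ' x = Real.exp (π.logDens x θ' - π.logDens x θ) := by
  rw [Real.exp_sub, logDens, logDens, Real.exp_log (π.dens_pos _ _ _),
    Real.exp_log (π.dens_pos _ _ _), ratio]

theorem measurable_ratio : Measurable (π.ratio θ θ') :=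
  (π.measurable_dens θ').div (π.measurable_dens θ)

theorem kernel_eq_withDensity (s : S) :
    π.kernel θ' s = (π.kernel θ s).withDensity fun a => ENNReal.ofReal (π.ratio θ θ' (s, a)) := by
  have h_dens (θ) : Measurable (Function.uncurry fun s a => ENNReal.ofReal (π.dens θ s a)) :=
    (π.measurable_dens θ).ennreal_ofReal
  have h_ratio : Measurable fun a => ENNReal.ofReal (π.ratio θ θ' (s, a)) :=
    ((π.measurable_ratio θ θ').comp measurable_prodMk_left).ennreal_ofReal
  rw [kernel, kernel, Kernel.withDensity_apply _ (h_dens θ'),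
    Kernel.withDensity_apply _ (h_dens θ),
    ← withDensity_mul _ (h_dens θ).of_uncurry_left h_ratio]
  refine congrArg _ (funext fun a => ?_)
  have h_pos := π.dens_pos θ s a
  rw [Pi.mul_apply, ← ENNReal.ofReal_mul h_pos.le, ratio, mul_div_cancel₀ _ h_pos.ne']

theorem compProd_kernel_eq_withDensity (μ : Measure S) [SFinite μ] :
    μ.compProd (π.kernel θ') =
      (μ.compProd (π.kernel θ)).withDensity fun x => ENNReal.ofReal (π.ratio θ θ' x) := by
  have h_ratio : Measurable (Function.uncurry fun s a => ENNReal.ofReal (π.ratio θ θ' (s, a))) :=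
    (π.measurable_ratio θ θ').ennreal_ofReal
  have h_kernel : π.kernel θ' =
      (π.kernel θ).withDensity fun s a => ENNReal.ofReal (π.ratio θ θ' (s, a)) :=
    Kernel.ext fun s => by rw [Kernel.withDensity_apply _ h_ratio, π.kernel_eq_withDensity θ θ']
  have : IsSFiniteKernel
      ((π.kernel θ).withDensity fun s a => ENNReal.ofReal (π.ratio θ θ' (s, a))) :=
    h_kernel ▸ inferInstance
  rw [h_kernel, Measure.compProd_withDensity h_ratio]

/-- The likelihood ratio of the trajectory up to time `T`. The transition probabilities do not
depend on the policy and cancel. -/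
def trajRatio (T : ℕ) (τ : ℕ → S × A) : ℝ :=
  ∏ t ∈ Finset.range (T + 1), π.ratio θ θ' (τ t)

theorem trajRatio_pos (T : ℕ) (τ : ℕ → S × A) : 0 < π.trajRatio θ θ' T τ :=
  Finset.prod_pos fun _ _ => π.ratio_pos _ _ _

theorem trajRatio_self (T : ℕ) (τ : ℕ → S × A) : π.trajRatio θ θ T τ = 1 :=
  Finset.prod_eq_one fun _ _ => π.ratio_self _ _

theorem trajRatio_eq_exp (T : ℕ) (τ : ℕ → S × A) :
    π.trajRatio θ θ' T τ =
      Real.exp (∑ t ∈ Finset.range (T + 1), (π.logDens (τ t) θ' - π.logDens (τ t) θ)) := by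
  simp only [trajRatio, ratio_eq_exp, Real.exp_sum]

theorem measurable_trajRatio (T : ℕ) : Measurable (π.trajRatio θ θ' T) :=
  Finset.measurable_prod _ fun t _ => (π.measurable_ratio θ θ').comp (measurable_pi_apply t)

end PolicyFamily

namespace CMDP

variable (M : CMDP S A m) (π : PolicyFamily S A d) (θ θ' : EuclideanSpace ℝ (Fin d))

theorem stepKernel_eq_withDensity (x : S × A) :
    M.stepKernel π θ' x =
      (M.stepKernel π θ x).withDensity fun y => ENNReal.ofReal (π.ratio θ θ' y) := by
  simp only [stepKernel, Kernel.compProd_apply_eq_compProd_sectR, Kernel.sectR_prodMkLeft]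
  exact π.compProd_kernel_eq_withDensity θ θ' (M.P x)

theorem map_frestrictLe_trajLaw_eq (T : ℕ) :
    (M.trajLaw π θ').map (Preorder.frestrictLe T) =
      ((M.trajLaw π θ).withDensity fun τ => ENNReal.ofReal (π.trajRatio θ θ' T τ)).map
        (Preorder.frestrictLe T) := by
  simp only [PolicyFamily.trajRatio,
    ENNReal.ofReal_prod_of_nonneg fun _ _ => (π.ratio_pos θ θ' _).le]
  exact map_frestrictLe_trajMeasure_of_withDensity (X := fun _ => S × A)
    (ℓ := fun _ x => ENNReal.ofReal (π.ratio θ θ' x))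
    (fun _ => (π.measurable_ratio θ θ').ennreal_ofReal)
    (π.compProd_kernel_eq_withDensity θ θ' M.ρ) (fun _ _ => M.stepKernel_eq_withDensity π θ θ' _) T

theorem lintegral_trajRatio (T : ℕ) :
    ∫⁻ τ, ENNReal.ofReal (π.trajRatio θ θ' T τ) ∂(M.trajLaw π θ) = 1 := by
  have h := congrArg (· Set.univ) (M.map_frestrictLe_trajLaw_eq π θ θ' T)
  simp only [Measure.map_apply (Preorder.measurable_frestrictLe T) .univ, Set.preimage_univ,
    measure_univ, withDensity_apply _ .univ, Measure.restrict_univ] at h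
  exact h.symm

theorem integrable_trajRatio (T : ℕ) : Integrable (π.trajRatio θ θ' T) (M.trajLaw π θ) := by
  refine ⟨(π.measurable_trajRatio θ θ' T).aestronglyMeasurable, ?_⟩
  rw [hasFiniteIntegral_iff_ofReal (.of_forall fun τ => (π.trajRatio_pos _ _ _ _).le),
    M.lintegral_trajRatio]
  exact ENNReal.one_lt_top

theorem integral_trajRatio (T : ℕ) : ∫ τ, π.trajRatio θ θ' T τ ∂(M.trajLaw π θ) = 1 := by
  rw [integral_eq_lintegral_of_nonneg_ae (.of_forall fun τ => (π.trajRatio_pos _ _ _ _).le)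
    (π.measurable_trajRatio θ θ' T).aestronglyMeasurable, M.lintegral_trajRatio, ENNReal.toReal_one]

theorem integral_eval_trajLaw_eq {E : Type*} [NormedAddCommGroup E] [NormedSpace ℝ E]
    {g : S × A → E} (hg : StronglyMeasurable g) (T : ℕ) :
    ∫ τ, g (τ T) ∂(M.trajLaw π θ') = ∫ τ, π.trajRatio θ θ' T τ • g (τ T) ∂(M.trajLaw π θ) := by
  have h_eval : StronglyMeasurable
      fun h : Finset.Iic T → S × A => g (h ⟨T, Finset.mem_Iic.2 le_rfl⟩) :=
    hg.comp_measurable (measurable_pi_apply _)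
  have h := congrArg (fun P => ∫ h, g (h ⟨T, Finset.mem_Iic.2 le_rfl⟩) ∂P)
    (M.map_frestrictLe_trajLaw_eq π θ θ' T)
  rw [integral_map (by fun_prop) h_eval.aestronglyMeasurable,
    integral_map (by fun_prop) h_eval.aestronglyMeasurable,
    integral_withDensity_eq_integral_toReal_smul (π.measurable_trajRatio θ θ' T).ennreal_ofReal
      (.of_forall fun _ => ENNReal.ofReal_lt_top)] at h
  simpa only [ENNReal.toReal_ofReal (π.trajRatio_pos θ θ' T _).le, Preorder.frestrictLe_apply]
    using h

end CMDP

end LikelihoodRatio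

section Scheffe

open Filter Topology

variable {Ω ι : Type*} [MeasurableSpace Ω] {μ : Measure Ω} {l : Filter ι} [l.IsCountablyGenerated]
  {f : ι → Ω → ℝ} {g : Ω → ℝ}

/- Scheffé's lemma. In `|f - g| = (f - g) + 2 (g - f)⁺` the positive part is dominated by `|g|`
because `f ≥ 0`, while the integral of `f - g` tends to `0` by assumption. -/
theorem tendsto_integral_abs_sub_of_tendsto_integral (hf : ∀ i, Integrable (f i) μ)
    (hf₀ : ∀ i ω, 0 ≤ f i ω) (hg : Integrable g μ)
    (h_lim : ∀ᵐ ω ∂μ, Tendsto (f · ω) l (𝓝 (g ω)))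
    (h_int : Tendsto (fun i => ∫ ω, f i ω ∂μ) l (𝓝 (∫ ω, g ω ∂μ))) :
    Tendsto (fun i => ∫ ω, |f i ω - g ω| ∂μ) l (𝓝 0) := by
  have h_pos_part (i) : Integrable (fun ω => max (g ω - f i ω) 0) μ := (hg.sub (hf i)).pos_part
  have h_tendsto : Tendsto (fun i => ∫ ω, max (g ω - f i ω) 0 ∂μ) l (𝓝 0) := by
    have h := tendsto_integral_filter_of_dominated_convergence (μ := μ) (l := l)
      (F := fun i ω => max (g ω - f i ω) 0) (f := fun _ => 0) (fun ω => |g ω|)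
      (.of_forall fun i => (h_pos_part i).aestronglyMeasurable)
      (.of_forall fun i => .of_forall fun ω => ?_) hg.abs ?_
    · simpa using h
    · rw [Real.norm_of_nonneg (le_max_right _ _)]
      exact max_le (by linarith [hf₀ i ω, le_abs_self (g ω)]) (abs_nonneg _)
    · filter_upwards [h_lim] with ω hω
      simpa using (hω.const_sub (g ω)).max (tendsto_const_nhds (x := (0 : ℝ)))
  have h_diff (i) : Integrable (fun ω => f i ω - g ω) μ := (hf i).sub hg
  have h_split (i) : ∫ ω, |f i ω - g ω| ∂μ =
      (∫ ω, f i ω ∂μ - ∫ ω, g ω ∂μ) + 2 * ∫ ω, max (g ω - f i ω) 0 ∂μ := by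
    rw [← integral_const_mul, ← integral_sub (hf i) hg,
      ← integral_add (h_diff i) ((h_pos_part i).const_mul 2)]
    refine integral_congr_ae (.of_forall fun ω => ?_)
    rcases le_total (f i ω) (g ω) with h | h
    · simp only [abs_of_nonpos (sub_nonpos.2 h), max_eq_left (sub_nonneg.2 h)]; ring
    · simp only [abs_of_nonneg (sub_nonneg.2 h), max_eq_right (sub_nonpos.2 h)]; ring
  simp only [h_split]
  simpa using (h_int.sub_const (∫ ω, g ω ∂μ)).add (h_tendsto.const_mul 2)

end Scheffe

section Continuity

open Filter Topology

variable {π : PolicyFamily S A d}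

theorem PolicyFamily.tendsto_trajRatio {θ : EuclideanSpace ℝ (Fin d)}
    (hπ : ∀ x, ContinuousAt (π.logDens x) θ) (T : ℕ) (τ : ℕ → S × A) :
    Tendsto (fun θ' => π.trajRatio θ θ' T τ) (𝓝 θ) (𝓝 1) := by
  have h : ContinuousAt (fun θ' => π.trajRatio θ θ' T τ) θ := by
    simp only [π.trajRatio_eq_exp]
    have := fun t => hπ (τ t)
    fun_prop
  simpa only [ContinuousAt, π.trajRatio_self] using h

namespace CMDP

variable (M : CMDP S A m)

theorem tendsto_integral_abs_trajRatio_sub_one {θ : EuclideanSpace ℝ (Fin d)}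
    (hπ : ∀ x, ContinuousAt (π.logDens x) θ) (T : ℕ) :
    Tendsto (fun θ' => ∫ τ, |π.trajRatio θ θ' T τ - 1| ∂(M.trajLaw π θ)) (𝓝 θ) (𝓝 0) :=
  tendsto_integral_abs_sub_of_tendsto_integral (fun θ' => M.integrable_trajRatio π θ θ' T)
    (fun θ' τ => (π.trajRatio_pos θ θ' T τ).le) (integrable_const 1)
    (.of_forall fun τ => PolicyFamily.tendsto_trajRatio hπ T τ)
    (by simp [M.integral_trajRatio])

theorem continuousAt_integral_eval_trajLaw {E : Type*} [NormedAddCommGroup E] [NormedSpace ℝ E]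
    {θ : EuclideanSpace ℝ (Fin d)} (hπ : ∀ x, ContinuousAt (π.logDens x) θ) {g : S × A → E}
    (hg : StronglyMeasurable g) {C : ℝ} (hC : ∀ x, ‖g x‖ ≤ C) (T : ℕ) :
    ContinuousAt (fun θ' => ∫ τ, g (τ T) ∂(M.trajLaw π θ')) θ := by
  have hgT : AEStronglyMeasurable (fun τ : ℕ → S × A => g (τ T)) (M.trajLaw π θ) :=
    (hg.comp_measurable (measurable_pi_apply T)).aestronglyMeasurable
  have h_int : Integrable (fun τ => g (τ T)) (M.trajLaw π θ) :=
    .of_bound hgT C (.of_forall fun τ => hC _)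
  rw [ContinuousAt, tendsto_iff_norm_sub_tendsto_zero]
  refine squeeze_zero (fun _ => norm_nonneg _) (fun θ' => ?_)
    (by simpa using (M.tendsto_integral_abs_trajRatio_sub_one hπ T).mul_const C)
  have h_ratio := M.integrable_trajRatio π θ θ' T
  have h_sub : Integrable (fun τ => π.trajRatio θ θ' T τ - 1) (M.trajLaw π θ) :=
    h_ratio.sub (integrable_const 1)
  have h_ratio_smul : Integrable (fun τ => π.trajRatio θ θ' T τ • g (τ T)) (M.trajLaw π θ) :=
    h_ratio.smul_bdd C hgT (.of_forall fun τ => hC _)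
  have h_diff : ∫ τ, g (τ T) ∂(M.trajLaw π θ') - ∫ τ, g (τ T) ∂(M.trajLaw π θ) =
      ∫ τ, (π.trajRatio θ θ' T τ - 1) • g (τ T) ∂(M.trajLaw π θ) := by
    rw [M.integral_eval_trajLaw_eq π θ θ' hg T, ← integral_sub h_ratio_smul h_int]
    simp only [sub_smul, one_smul]
  rw [h_diff, ← integral_mul_const]
  refine norm_integral_le_of_norm_le (h_sub.abs.mul_const C) (.of_forall fun τ => ?_)
  rw [norm_smul]
  exact mul_le_mul_of_nonneg_left (hC _) (norm_nonneg _)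

end CMDP

end Continuity

section DiscountedRewards

namespace CMDP

variable (M : CMDP S A m) (π : PolicyFamily S A d) (i : Fin (m + 1)) (t : ℕ)

/-- The contribution `γ^t r_i(s_t, a_t)` of time `t` to the return. -/
def discountedReward (τ : ℕ → S × A) : ℝ :=
  M.γ ^ t * M.r i (τ t)

theorem measurable_discountedReward : Measurable (M.discountedReward i t) :=
  ((M.measurable_r i).comp (measurable_pi_apply t)).const_mul _

theorem norm_pow_mul_r_le (x : S × A) : ‖M.γ ^ t * M.r i x‖ ≤ M.γ ^ t := by
  have h_pow := pow_nonneg M.γ_mem.1.le t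
  rw [norm_mul, Real.norm_of_nonneg h_pow]
  exact mul_le_of_le_one_right h_pow (abs_le.2 (M.r_mem i x))

theorem norm_discountedReward_le (τ : ℕ → S × A) : ‖M.discountedReward i t τ‖ ≤ M.γ ^ t :=
  M.norm_pow_mul_r_le i t (τ t)

theorem hasSum_pow_γ : HasSum (fun t => M.γ ^ t) (1 - M.γ)⁻¹ :=
  hasSum_geometric_of_lt_one M.γ_mem.1.le M.γ_mem.2

theorem hasSum_integral_discountedReward (θ : EuclideanSpace ℝ (Fin d)) :
    HasSum (fun t => ∫ τ, M.discountedReward i t τ ∂(M.trajLaw π θ)) (M.value π i θ) :=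
  hasSum_integral_of_norm_le
    (fun t => (M.measurable_discountedReward i t).aestronglyMeasurable) M.hasSum_pow_γ.summable
    (M.norm_discountedReward_le i)

theorem continuous_value (hπ : ∀ x, Continuous (π.logDens x)) : Continuous (M.value π i) := by
  have h_value : M.value π i = fun θ => ∑' t, ∫ τ, M.discountedReward i t τ ∂(M.trajLaw π θ) :=
    funext fun θ => (M.hasSum_integral_discountedReward π i θ).tsum_eq.symm
  rw [h_value]
  refine continuous_tsum (fun t => ?_) M.hasSum_pow_γ.summable fun t θ =>
    norm_integral_le_of_norm_le_const (.of_forall (M.norm_discountedReward_le i t)) |>.trans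
      (by simp)
  exact continuous_iff_continuousAt.2 fun θ => M.continuousAt_integral_eval_trajLaw
    (fun x => (hπ x).continuousAt) ((M.measurable_r i).const_mul _).stronglyMeasurable
    (M.norm_pow_mul_r_le i t) t

end CMDP

end DiscountedRewards

section Gradient

open Filter Topology InnerProductSpace

variable {E : Type*} [NormedAddCommGroup E] [InnerProductSpace ℝ E]

theorem measurable_gradient [FiniteDimensional ℝ E] [MeasurableSpace E] [BorelSpace E]
    {Ω : Type*} [MeasurableSpace Ω] {f : Ω → E → ℝ} {x : E} (hf : ∀ y, Measurable (f · y))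
    (hd : ∀ ω, DifferentiableAt ℝ (f ω) x) : Measurable fun ω => gradient (f ω) x := by
  have h_inner (v : E) : Measurable fun ω => inner ℝ (gradient (f ω) x) v := by
    refine measurable_of_tendsto_metrizable
      (f := fun (n : ℕ) ω => (n : ℝ) * (f ω (x + (n : ℝ)⁻¹ • v) - f ω x))
      (fun n => ((hf _).sub (hf x)).const_mul _) (tendsto_pi_nhds.2 fun ω => ?_)
    simpa using (hd ω).hasGradientAt.hasFDerivAt.lim v
      (tendsto_norm_atTop_atTop.comp (tendsto_natCast_atTop_atTop (R := ℝ)))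
  let b := stdOrthonormalBasis ℝ E
  have h_repr : (fun ω => gradient (f ω) x) =
      fun ω => ∑ k, inner ℝ (gradient (f ω) x) (b k) • b k :=
    funext fun ω => by simpa only [real_inner_comm] using (b.sum_repr' (gradient (f ω) x)).symm
  rw [h_repr]
  exact Finset.measurable_sum _ fun k _ => (h_inner (b k)).smul_const (b k)

variable [CompleteSpace E]

theorem hasGradientAt_integral_of_dominated {Ω : Type*} [MeasurableSpace Ω] {μ : Measure Ω}
    {F : E → Ω → ℝ} {G : E → Ω → E} {bound : Ω → ℝ} {s : Set E} {x₀ : E} (hs : s ∈ 𝓝 x₀)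
    (hF : ∀ x, AEStronglyMeasurable (F x) μ) (hF_int : Integrable (F x₀) μ)
    (hG : AEStronglyMeasurable (G x₀) μ) (hG_le : ∀ ω, ∀ x ∈ s, ‖G x ω‖ ≤ bound ω)
    (h_bound : Integrable bound μ) (h_grad : ∀ ω, ∀ x ∈ s, HasGradientAt (F · ω) (G x ω) x) :
    HasGradientAt (fun x => ∫ ω, F x ω ∂μ) (∫ ω, G x₀ ω ∂μ) x₀ := by
  have hx₀ := mem_of_mem_nhds hs
  have hG_int : Integrable (G x₀) μ := h_bound.mono' hG (.of_forall fun ω => hG_le ω x₀ hx₀)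
  have hG' : AEStronglyMeasurable (fun ω => toDual ℝ E (G x₀ ω)) μ :=
    (toDual ℝ E).continuous.comp_aestronglyMeasurable hG
  have hG'_le (ω) (x) (hx : x ∈ s) : ‖toDual ℝ E (G x ω)‖ ≤ bound ω := by
    rw [LinearIsometryEquiv.norm_map]; exact hG_le ω x hx
  have h := hasFDerivAt_integral_of_dominated_of_fderiv_le (μ := μ) (bound := bound) (F := F)
    (F' := fun x ω => toDual ℝ E (G x ω)) hs (.of_forall hF) hF_int hG'
    (.of_forall hG'_le) h_bound (.of_forall fun ω x hx => (h_grad ω x hx).hasFDerivAt)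
  rw [hasGradientAt_iff_hasFDerivAt]
  convert! h using 1
  ext v
  rw [ContinuousLinearMap.integral_apply
    (h_bound.mono' hG' (.of_forall fun ω => hG'_le ω x₀ hx₀))]
  simp only [toDual_apply_apply]
  simp_rw [real_inner_comm v]
  exact (integral_inner hG_int v).symm

theorem hasGradientAt_tsum_of_ball {f : ℕ → E → ℝ} {g : ℕ → E → E} {u : ℕ → ℝ} {x₀ : E} {R : ℝ}
    (hR : 0 < R) (hu : Summable u)
    (hf : ∀ n, ∀ x ∈ Metric.ball x₀ R, HasGradientAt (f n) (g n x) x)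
    (hg : ∀ n, ∀ x ∈ Metric.ball x₀ R, ‖g n x‖ ≤ u n) (hf₀ : Summable fun n => f n x₀) :
    HasGradientAt (fun x => ∑' n, f n x) (∑' n, g n x₀) x₀ := by
  have hx₀ := Metric.mem_ball_self (x := x₀) hR
  have h := hasFDerivAt_tsum_of_isPreconnected hu Metric.isOpen_ball
    (convex_ball x₀ R).isPreconnected (f := f) (f' := fun n x => toDual ℝ E (g n x))
    (fun n x hx => (hf n x hx).hasFDerivAt)
    (fun n x hx => by rw [LinearIsometryEquiv.norm_map]; exact hg n x hx) hx₀ hf₀ hx₀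
  have hg_summable : Summable fun n => g n x₀ := .of_norm_bounded hu fun n => hg n x₀ hx₀
  rw [hasGradientAt_iff_hasFDerivAt]
  convert! h using 1
  exact (hg_summable.hasSum.map (toDual ℝ E) (toDual ℝ E).continuous).tsum_eq.symm

end Gradient

section PolicyGradient

open Filter Topology InnerProductSpace

namespace PolicyFamily

variable (π : PolicyFamily S A d)

theorem measurable_score {θ : EuclideanSpace ℝ (Fin d)}
    (hπ : ∀ x, DifferentiableAt ℝ (π.logDens x) θ) : Measurable fun x => π.score x θ :=
  measurable_gradient (fun θ' => Real.measurable_log.comp (π.measurable_dens θ')) hπ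

/-- The score `∑_{t ≤ T} ∇_θ log π_θ(a_t | s_t)` of the trajectory up to time `T`. -/
def scoreSum (θ : EuclideanSpace ℝ (Fin d)) (T : ℕ) (τ : ℕ → S × A) :
    EuclideanSpace ℝ (Fin d) :=
  ∑ t ∈ Finset.range (T + 1), π.score (τ t) θ

theorem measurable_scoreSum {θ : EuclideanSpace ℝ (Fin d)}
    (hπ : ∀ x, DifferentiableAt ℝ (π.logDens x) θ) (T : ℕ) : Measurable (π.scoreSum θ T) :=
  Finset.measurable_sum _ fun t _ => (π.measurable_score hπ).comp (measurable_pi_apply t)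

theorem norm_scoreSum_le {θ : EuclideanSpace ℝ (Fin d)} {Mg : ℝ} (hg : ∀ x, ‖π.score x θ‖ ≤ Mg)
    (T : ℕ) (τ : ℕ → S × A) : ‖π.scoreSum θ T τ‖ ≤ (T + 1) * Mg :=
  (norm_sum_le _ _).trans ((Finset.sum_le_sum fun t _ => hg (τ t)).trans_eq (by simp))

theorem hasGradientAt_trajRatio (θ : EuclideanSpace ℝ (Fin d)) {θ' : EuclideanSpace ℝ (Fin d)}
    (hπ : ∀ x, DifferentiableAt ℝ (π.logDens x) θ') (T : ℕ) (τ : ℕ → S × A) :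
    HasGradientAt (fun θ' => π.trajRatio θ θ' T τ) (π.trajRatio θ θ' T τ • π.scoreSum θ' T τ)
      θ' := by
  have h_term (t : ℕ) : HasFDerivAt (fun θ' => π.logDens (τ t) θ' - π.logDens (τ t) θ)
      (toDual ℝ _ (π.score (τ t) θ')) θ' :=
    (hπ (τ t)).hasGradientAt.hasFDerivAt.sub_const _
  have h_exp := (HasFDerivAt.fun_sum (u := Finset.range (T + 1)) fun t _ => h_term t).exp
  simp only [hasGradientAt_iff_hasFDerivAt, trajRatio_eq_exp]
  convert! h_exp using 1
  simp [scoreSum]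

variable {π} {θ : EuclideanSpace ℝ (Fin d)} {R Mg : ℝ}

theorem ratio_le (hπ : ∀ θ' ∈ Metric.ball θ R, ∀ x, DifferentiableAt ℝ (π.logDens x) θ')
    (hMg : 0 ≤ Mg) (hg : ∀ θ' ∈ Metric.ball θ R, ∀ x, ‖π.score x θ'‖ ≤ Mg)
    {θ' : EuclideanSpace ℝ (Fin d)} (hθ' : θ' ∈ Metric.ball θ R) (x : S × A) :
    π.ratio θ θ' x ≤ Real.exp (Mg * R) := by
  have h_lip : ‖π.logDens x θ' - π.logDens x θ‖ ≤ Mg * ‖θ' - θ‖ := by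
    refine (convex_ball θ R).norm_image_sub_le_of_norm_fderiv_le (𝕜 := ℝ)
      (fun y hy => hπ y hy x) (fun y hy => ?_)
      (Metric.mem_ball_self (Metric.pos_of_mem_ball hθ')) hθ'
    rw [← toDual_gradient, LinearIsometryEquiv.norm_map]
    exact hg y hy x
  rw [ratio_eq_exp]
  refine Real.exp_le_exp.2 ((le_abs_self _).trans (h_lip.trans ?_))
  exact mul_le_mul_of_nonneg_left (mem_ball_iff_norm.1 hθ').le hMg

theorem trajRatio_le (hπ : ∀ θ' ∈ Metric.ball θ R, ∀ x, DifferentiableAt ℝ (π.logDens x) θ')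
    (hMg : 0 ≤ Mg) (hg : ∀ θ' ∈ Metric.ball θ R, ∀ x, ‖π.score x θ'‖ ≤ Mg)
    {θ' : EuclideanSpace ℝ (Fin d)} (hθ' : θ' ∈ Metric.ball θ R) (T : ℕ) (τ : ℕ → S × A) :
    π.trajRatio θ θ' T τ ≤ Real.exp (Mg * R) ^ (T + 1) :=
  (Finset.prod_le_prod (fun _ _ => (π.ratio_pos _ _ _).le)
    fun t _ => ratio_le hπ hMg hg hθ' (τ t)).trans_eq (by simp)

end PolicyFamily

namespace CMDP

variable (M : CMDP S A m) {π : PolicyFamily S A d} {θ : EuclideanSpace ℝ (Fin d)} {Mg : ℝ}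

theorem hasGradientAt_integral_eval_trajLaw (hπ : ∀ x, Differentiable ℝ (π.logDens x))
    (hMg : 0 ≤ Mg) (h_score : ∀ᶠ θ' in 𝓝 θ, ∀ x, ‖π.score x θ'‖ ≤ Mg) {g : S × A → ℝ}
    (hg : Measurable g) {C : ℝ} (hC : ∀ x, ‖g x‖ ≤ C) (T : ℕ) :
    HasGradientAt (fun θ' => ∫ τ, g (τ T) ∂(M.trajLaw π θ'))
      (∫ τ, g (τ T) • π.scoreSum θ T τ ∂(M.trajLaw π θ)) θ := by
  obtain ⟨R, hR, h_score⟩ := Metric.eventually_nhds_iff_ball.1 h_score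
  have hgT : Measurable fun τ : ℕ → S × A => g (τ T) := hg.comp (measurable_pi_apply T)
  have h_scoreSum := π.measurable_scoreSum (fun x => hπ x θ) T
  have h := hasGradientAt_integral_of_dominated (μ := M.trajLaw π θ)
    (F := fun θ' τ => π.trajRatio θ θ' T τ • g (τ T))
    (G := fun θ' τ => g (τ T) • (π.trajRatio θ θ' T τ • π.scoreSum θ' T τ))
    (bound := fun _ => C * (Real.exp (Mg * R) ^ (T + 1) * ((T + 1) * Mg)))
    (Metric.ball_mem_nhds θ hR)
    (fun θ' => ((π.measurable_trajRatio θ θ' T).smul hgT).aestronglyMeasurable)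
    (by simpa only [π.trajRatio_self, one_smul] using
      .of_bound hgT.aestronglyMeasurable C (.of_forall fun τ => hC _))
    (hgT.smul ((π.measurable_trajRatio θ θ T).smul h_scoreSum)).aestronglyMeasurable
    (fun τ θ' hθ' => ?_) (integrable_const _) (fun τ θ' _ => ?_)
  · simpa only [← M.integral_eval_trajLaw_eq π θ _ hg.stronglyMeasurable, π.trajRatio_self,
      one_smul] using h
  · have h_trajRatio := PolicyFamily.trajRatio_le (fun θ' _ x => hπ x θ') hMg h_score hθ' T τ
    have h_pos := (π.trajRatio_pos θ θ' T τ).le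
    rw [norm_smul, norm_smul, Real.norm_of_nonneg h_pos]
    gcongr
    exacts [(norm_nonneg _).trans (hC (τ T)), hC _, π.norm_scoreSum_le (h_score θ' hθ') T τ]
  · rw [hasGradientAt_iff_hasFDerivAt]
    convert! (π.hasGradientAt_trajRatio θ (hπ · θ') T τ).hasFDerivAt.mul_const (g (τ T)) using 1
    ext v
    simp

variable (π) in
/-- The contribution of the reward at time `t` to the policy-gradient estimator; only the scores up
to time `t` enter. -/
def discountedScore (θ : EuclideanSpace ℝ (Fin d)) (i : Fin (m + 1)) (t : ℕ) (τ : ℕ → S × A) :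
    EuclideanSpace ℝ (Fin d) :=
  M.discountedReward i t τ • π.scoreSum θ t τ

variable (π) in
/-- The right-hand side of the policy gradient theorem, the expectation of
`∑_t γ^t r_i(s_t, a_t) ∑_{t' ≤ t} ∇_θ log π_θ(a_{t'} | s_{t'})`. -/
def valueGrad (i : Fin (m + 1)) (θ : EuclideanSpace ℝ (Fin d)) : EuclideanSpace ℝ (Fin d) :=
  ∫ τ, ∑' t, M.discountedScore π θ i t τ ∂(M.trajLaw π θ)

theorem measurable_discountedScore (hπ : ∀ x, DifferentiableAt ℝ (π.logDens x) θ)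
    (i : Fin (m + 1)) (t : ℕ) : Measurable (M.discountedScore π θ i t) :=
  (M.measurable_discountedReward i t).smul (π.measurable_scoreSum hπ t)

theorem norm_discountedScore_le (h_score : ∀ x, ‖π.score x θ‖ ≤ Mg) (i : Fin (m + 1)) (t : ℕ)
    (τ : ℕ → S × A) : ‖M.discountedScore π θ i t τ‖ ≤ Mg * ((t + 1) * M.γ ^ t) := by
  rw [discountedScore, norm_smul]
  calc ‖M.discountedReward i t τ‖ * ‖π.scoreSum θ t τ‖ ≤ M.γ ^ t * ((t + 1) * Mg) := by
        gcongr
        exacts [pow_nonneg M.γ_mem.1.le t, M.norm_discountedReward_le i t τ,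
          π.norm_scoreSum_le h_score t τ]
    _ = _ := by ring

theorem hasSum_add_one_mul_pow_γ : HasSum (fun t : ℕ => (t + 1) * M.γ ^ t) ((1 - M.γ)⁻¹ ^ 2) :=
  hasSum_add_one_mul_pow M.γ_mem.1.le M.γ_mem.2

theorem hasSum_integral_discountedScore (hπ : ∀ x, DifferentiableAt ℝ (π.logDens x) θ)
    (h_score : ∀ x, ‖π.score x θ‖ ≤ Mg) (i : Fin (m + 1)) :
    HasSum (fun t => ∫ τ, M.discountedScore π θ i t τ ∂(M.trajLaw π θ)) (M.valueGrad π i θ) :=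
  hasSum_integral_of_norm_le (fun t => (M.measurable_discountedScore hπ i t).aestronglyMeasurable)
    (M.hasSum_add_one_mul_pow_γ.summable.mul_left Mg) (M.norm_discountedScore_le h_score i)

theorem hasGradientAt_value (hπ : ∀ x, Differentiable ℝ (π.logDens x)) (hMg : 0 ≤ Mg)
    (h_score : ∀ᶠ θ' in 𝓝 θ, ∀ x, ‖π.score x θ'‖ ≤ Mg) (i : Fin (m + 1)) :
    HasGradientAt (M.value π i) (M.valueGrad π i θ) θ := by
  obtain ⟨R, hR, h_score⟩ := Metric.eventually_nhds_iff_ball.1 h_score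
  have h_value : M.value π i = fun θ => ∑' t, ∫ τ, M.discountedReward i t τ ∂(M.trajLaw π θ) :=
    funext fun θ => (M.hasSum_integral_discountedReward π i θ).tsum_eq.symm
  rw [h_value, ← (M.hasSum_integral_discountedScore (fun x => hπ x θ)
    (h_score θ (Metric.mem_ball_self hR)) i).tsum_eq]
  refine hasGradientAt_tsum_of_ball
    (g := fun t θ => ∫ τ, M.discountedScore π θ i t τ ∂(M.trajLaw π θ)) hR
    (M.hasSum_add_one_mul_pow_γ.summable.mul_left Mg) (fun t θ' hθ' => ?_) (fun t θ' hθ' => ?_)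
    (M.hasSum_integral_discountedReward π i θ).summable
  · exact M.hasGradientAt_integral_eval_trajLaw hπ hMg
      (Filter.eventually_of_mem (Metric.isOpen_ball.mem_nhds hθ') h_score)
      ((M.measurable_r i).const_mul _) (M.norm_pow_mul_r_le i t) t
  · simpa using norm_integral_le_of_norm_le_const (μ := M.trajLaw π θ')
      (.of_forall (M.norm_discountedScore_le (h_score θ' hθ') i t))

theorem eventually_score_le (hπ : ∀ x, Continuous (π.logDens x))
    (h_score : ∀ θ' ∈ M.feasible π, ∀ x, ‖π.score x θ'‖ ≤ Mg)
    (h_pos : ∀ i : Fin m, 0 < M.value π i.succ θ) :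
    ∀ᶠ θ' in 𝓝 θ, ∀ x, ‖π.score x θ'‖ ≤ Mg := by
  have h_feasible : ∀ᶠ θ' in 𝓝 θ, ∀ i : Fin m, 0 < M.value π i.succ θ' :=
    eventually_all.2 fun i =>
      ((M.continuous_value π i.succ hπ).tendsto θ).eventually_const_lt (h_pos i)
  exact h_feasible.mono fun θ' hθ' => h_score θ' fun i => (hθ' i).le

end CMDP

end PolicyGradient

section Accuracy

theorem one_sub_card_mul_le_measureReal_setOf_forall {Ω ι : Type*} [MeasurableSpace Ω] [Fintype ι]
    {μ : Measure Ω} [IsProbabilityMeasure μ] {P : ι → Ω → Prop} {p : ℝ}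
    (hp : ∀ i, μ.real {ω | ¬ P i ω} ≤ p) :
    1 - Fintype.card ι * p ≤ μ.real {ω | ∀ i, P i ω} := by
  have h_cover : Set.univ ⊆ {ω | ∀ i, P i ω} ∪ ⋃ i, {ω | ¬ P i ω} := fun ω _ => by
    simpa only [Set.mem_union, Set.mem_iUnion, Set.mem_ofPred_eq, ← not_forall] using em _
  have h_univ := (measureReal_mono (μ := μ) h_cover).trans (measureReal_union_le _ _)
  have h_bad : μ.real (⋃ i, {ω | ¬ P i ω}) ≤ Fintype.card ι * p :=
    (measureReal_iUnion_fintype_le _).trans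
      ((Finset.sum_le_card_nsmul _ _ p fun i _ => hp i).trans_eq (nsmul_eq_mul _ _))
  rw [probReal_univ] at h_univ
  linarith

theorem norm_inv_smul_sub_inv_smul_le {E : Type*} [NormedAddCommGroup E] [NormedSpace ℝ E]
    {x x' v α β L : ℝ} {g g' : E} (hv : 0 < v) (hx : v ≤ x) (hxx : ‖x' - x‖ ≤ β) (hβ : β ≤ v / 2)
    (hg : ‖g‖ ≤ L) (hgg : ‖g' - g‖ ≤ α) :
    ‖x'⁻¹ • g' - x⁻¹ • g‖ ≤ 2 / v * α + 2 / v ^ 2 * L * β := by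
  have hx0 : 0 < x := hv.trans_le hx
  have hx' : v / 2 ≤ x' := by linarith [(abs_le.1 hxx).1]
  have hx'0 : 0 < x' := (half_pos hv).trans_le hx'
  have hβ0 : 0 ≤ β := (norm_nonneg _).trans hxx
  have h_inv : x'⁻¹ ≤ 2 / v := inv_div v 2 ▸ inv_anti₀ (half_pos hv) hx'
  have h_inv_sub : ‖x'⁻¹ - x⁻¹‖ ≤ 2 / v ^ 2 * β :=
    calc ‖x'⁻¹ - x⁻¹‖ = x'⁻¹ * ‖x' - x‖ * x⁻¹ := by
          rw [inv_sub_inv hx'0.ne' hx0.ne', norm_div, norm_mul, norm_sub_rev,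
            Real.norm_of_nonneg hx'0.le, Real.norm_of_nonneg hx0.le]
          field_simp
      _ ≤ 2 / v * β * v⁻¹ := by gcongr
      _ = 2 / v ^ 2 * β := by field_simp
  calc ‖x'⁻¹ • g' - x⁻¹ • g‖ = ‖x'⁻¹ • (g' - g) + (x'⁻¹ - x⁻¹) • g‖ := by
        rw [smul_sub, sub_smul, sub_add_sub_cancel]
    _ ≤ x'⁻¹ * ‖g' - g‖ + ‖x'⁻¹ - x⁻¹‖ * ‖g‖ := by
        refine (norm_add_le _ _).trans_eq ?_
        rw [norm_smul, norm_smul, Real.norm_of_nonneg (inv_pos.2 hx'0).le]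
    _ ≤ 2 / v * α + 2 / v ^ 2 * β * L := by gcongr
    _ = _ := by ring

theorem norm_add_smul_sum_inv_smul_sub_le {E ι : Type*} [NormedAddCommGroup E] [NormedSpace ℝ E]
    [Fintype ι] {g₀ g₀' : E} {g g' : ι → E} {x x' : ι → ℝ} {v α β L η : ℝ} (hv : 0 < v)
    (hη : 0 ≤ η) (hx : ∀ i, v ≤ x i) (hxx : ∀ i, ‖x' i - x i‖ ≤ β) (hβ : β ≤ v / 2)
    (hg : ∀ i, ‖g i‖ ≤ L) (hgg₀ : ‖g₀' - g₀‖ ≤ α) (hgg : ∀ i, ‖g' i - g i‖ ≤ α) :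
    ‖(g₀' + η • ∑ i, (x' i)⁻¹ • g' i) - (g₀ + η • ∑ i, (x i)⁻¹ • g i)‖ ≤
      α + η * (Fintype.card ι * (2 / v * α + 2 / v ^ 2 * L * β)) := by
  rw [add_sub_add_comm, ← smul_sub, ← Finset.sum_sub_distrib]
  refine (norm_add_le _ _).trans (add_le_add hgg₀ ?_)
  rw [norm_smul, Real.norm_of_nonneg hη, ← nsmul_eq_mul]
  gcongr
  exact norm_sum_le_of_le _ (fun i _ => norm_inv_smul_sub_inv_smul_le hv (hx i) (hxx i) hβ
    (hg i) (hgg i)) |>.trans_eq (Finset.sum_const _)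

end Accuracy

section Estimators

open Filter Topology

variable (M : CMDP S A m) (π : PolicyFamily S A d) {θ : EuclideanSpace ℝ (Fin d)}
  {Mg a b p : ℝ} {n H : ℕ}

namespace CMDP

theorem minValue_le (θ : EuclideanSpace ℝ (Fin d)) (i : Fin m) :
    M.minValue π θ ≤ M.value π i.succ θ :=
  ciInf_le (Set.finite_range _).bddBelow i

theorem minValue_pos (hm : 1 ≤ m) (h_pos : ∀ i : Fin m, 0 < M.value π i.succ θ) :
    0 < M.minValue π θ := by
  have : Nonempty (Fin m) := ⟨⟨0, hm⟩⟩
  obtain ⟨i, hi⟩ := exists_eq_ciInf_of_finite (f := fun i : Fin m => M.value π i.succ θ)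
  exact (h_pos i).trans_eq hi

theorem gradEst_eq_mean_discountedScore (θ : EuclideanSpace ℝ (Fin d)) (H : ℕ) {n : ℕ}
    (i : Fin (m + 1)) (ω : Fin n → ℕ → S × A) :
    M.gradEst π θ H i ω =
      (n : ℝ)⁻¹ • ∑ j, ∑ t ∈ Finset.range H, M.discountedScore π θ i t (ω j) := by
  simp only [gradEst, discountedScore, discountedReward, PolicyFamily.scoreSum, Finset.smul_sum]

theorem measureReal_lt_norm_valueEst_sub_value_le (i : Fin (m + 1)) (hb : 0 < b) (hp : 0 < p)
    (hn : 64 * ((1 - M.γ)⁻¹ / b) ^ 2 * Real.log (2 / p) ≤ n)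
    (hH : (1 - M.γ)⁻¹ - ∑ t ∈ Finset.range H, M.γ ^ t ≤ b / 2) :
    (M.batchLaw π θ n).real {ω | b < ‖M.valueEst H i ω - M.value π i θ‖} ≤ p :=
  measureReal_lt_norm_mean_truncated_series_sub_le (M.measurable_discountedReward i) M.hasSum_pow_γ
    (inv_pos.2 (sub_pos.2 M.γ_mem.2)) (M.norm_discountedReward_le i) hb hp hn hH

variable {π}

theorem hasGradientAt_logBarrier (hπ : ∀ x, Differentiable ℝ (π.logDens x)) (hMg : 0 ≤ Mg)
    (h_score : ∀ᶠ θ' in 𝓝 θ, ∀ x, ‖π.score x θ'‖ ≤ Mg)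
    (h_pos : ∀ i : Fin m, 0 < M.value π i.succ θ) (η : ℝ) :
    HasGradientAt (M.logBarrier π η) (M.valueGrad π 0 θ +
      η • ∑ i : Fin m, (M.value π i.succ θ)⁻¹ • M.valueGrad π i.succ θ) θ := by
  have h_value i := (M.hasGradientAt_value hπ hMg h_score i).hasFDerivAt
  rw [hasGradientAt_iff_hasFDerivAt]
  have h := (h_value 0).add ((HasFDerivAt.fun_sum (u := Finset.univ) fun (i : Fin m) _ =>
    (h_value i.succ).log (h_pos i).ne').const_mul η)
  convert! h using 1
  simp

theorem norm_valueGrad_le (h_score : ∀ x, ‖π.score x θ‖ ≤ Mg) (i : Fin (m + 1)) :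
    ‖M.valueGrad π i θ‖ ≤ Mg * (1 - M.γ)⁻¹ ^ 2 := by
  have h_sum := M.hasSum_add_one_mul_pow_γ.mul_left Mg
  refine (norm_integral_le_of_norm_le_const (ae_of_all _ fun τ =>
    tsum_of_norm_bounded h_sum (M.norm_discountedScore_le h_score i · τ))).trans_eq ?_
  rw [probReal_univ, mul_one]

theorem measureReal_lt_norm_gradEst_sub_valueGrad_le
    (hπ : ∀ x, DifferentiableAt ℝ (π.logDens x) θ) (hMg : 0 < Mg)
    (h_score : ∀ x, ‖π.score x θ‖ ≤ Mg) (i : Fin (m + 1)) (ha : 0 < a) (hp : 0 < p)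
    (hn : 64 * (Mg * (1 - M.γ)⁻¹ ^ 2 / a) ^ 2 * Real.log (2 / p) ≤ n)
    (hH : Mg * (1 - M.γ)⁻¹ ^ 2 - ∑ t ∈ Finset.range H, Mg * ((t + 1) * M.γ ^ t) ≤ a / 2) :
    (M.batchLaw π θ n).real {ω | a < ‖M.gradEst π θ H i ω - M.valueGrad π i θ‖} ≤ p := by
  have h1γ : 0 < 1 - M.γ := sub_pos.2 M.γ_mem.2
  simp only [gradEst_eq_mean_discountedScore]
  exact measureReal_lt_norm_mean_truncated_series_sub_le (M.measurable_discountedScore hπ i)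
    (M.hasSum_add_one_mul_pow_γ.mul_left Mg) (by positivity)
    (M.norm_discountedScore_le h_score i) ha hp hn hH

theorem one_sub_le_measureReal_norm_estimators_sub_le
    (hπ : ∀ x, DifferentiableAt ℝ (π.logDens x) θ) (hMg : 0 < Mg)
    (h_score : ∀ x, ‖π.score x θ‖ ≤ Mg) (ha : 0 < a) (hb : 0 < b) (hp : 0 < p)
    (hna : 64 * (Mg * (1 - M.γ)⁻¹ ^ 2 / a) ^ 2 * Real.log (2 / p) ≤ n)
    (hnb : 64 * ((1 - M.γ)⁻¹ / b) ^ 2 * Real.log (2 / p) ≤ n)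
    (hHa : Mg * (1 - M.γ)⁻¹ ^ 2 - ∑ t ∈ Finset.range H, Mg * ((t + 1) * M.γ ^ t) ≤ a / 2)
    (hHb : (1 - M.γ)⁻¹ - ∑ t ∈ Finset.range H, M.γ ^ t ≤ b / 2) :
    1 - 2 * (m + 1) * p ≤ (M.batchLaw π θ n).real
      {ω | ∀ i, ‖M.gradEst π θ H i ω - M.valueGrad π i θ‖ ≤ a ∧
        ‖M.valueEst H i ω - M.value π i θ‖ ≤ b} := by
  have : IsProbabilityMeasure (M.batchLaw π θ n) := by unfold batchLaw; infer_instance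
  refine le_trans (le_of_eq ?_) (one_sub_card_mul_le_measureReal_setOf_forall (p := p + p)
    fun i => ?_)
  · rw [Fintype.card_fin]; push_cast; ring
  · simp only [not_and_or, not_le, Set.ofPred_or]
    exact (measureReal_union_le _ _).trans (add_le_add
      (M.measureReal_lt_norm_gradEst_sub_valueGrad_le hπ hMg h_score i ha hp hna hHa)
      (M.measureReal_lt_norm_valueEst_sub_value_le π i hb hp hnb hHb))

end CMDP

end Estimators

section Thresholds

/-- Reciprocal of the accuracy required of the gradient estimators. It makes their share of the
error of the plug-in estimator exactly `ε / 2`. -/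
def gradPrecision (m : ℕ) (η ε v : ℝ) : ℝ :=
  2 / ε * (1 + 2 * η * m / v)

/-- Reciprocal of the accuracy required of the value estimators, where `L` bounds the gradients.
The summand `2 / v` keeps the estimated values above `v / 2`, and the other one makes their share
of the error of the plug-in estimator at most `ε / 2`. -/
def valuePrecision (m : ℕ) (L η ε v : ℝ) : ℝ :=
  2 / v + 4 * η * m * L / (ε * v ^ 2)

/-- The threshold `n₀`, which makes each of the `2 (m + 1)` estimators accurate up to a failure
probability of `δ / (2 (m + 1))`. -/
def batchThreshold (m : ℕ) (Mg γ η ε δ v : ℝ) : ℕ :=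
  ⌈64 * ((Mg * (1 - γ)⁻¹ ^ 2 * gradPrecision m η ε v) ^ 2 +
    ((1 - γ)⁻¹ * valuePrecision m (Mg * (1 - γ)⁻¹ ^ 2) η ε v) ^ 2) *
      Real.log (4 * (m + 1) / δ)⌉₊

/-- The number whose reciprocal `√γ ^ H` must not exceed for the truncation at horizon `H` to be
harmless. -/
def horizonFactor (m : ℕ) (Mg γ η ε v : ℝ) : ℝ :=
  2 * (Mg * gradPrecision m η ε v + valuePrecision m (Mg * (1 - γ)⁻¹ ^ 2) η ε v) *
    (1 - √γ)⁻¹ ^ 2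

/-- The threshold `H₀`. -/
def horizonThreshold (m : ℕ) (Mg γ η ε v : ℝ) : ℕ :=
  ⌈Real.logb (√γ)⁻¹ (horizonFactor m Mg γ η ε v)⌉₊

theorem sqrt_lt_one {x : ℝ} (hx : x < 1) : √x < 1 :=
  (Real.sqrt_lt' one_pos).2 (by rwa [one_pow])

theorem sub_sum_range_le_of_le {u w : ℕ → ℝ} {U W : ℝ} (hu : HasSum u U) (hw : HasSum w W)
    (hw0 : ∀ t, 0 ≤ w t) {H : ℕ} (huw : ∀ t, H ≤ t → u t ≤ w t) :
    U - ∑ t ∈ Finset.range H, u t ≤ W :=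
  (hasSum_le (fun t => huw (t + H) (Nat.le_add_left H t)) ((hasSum_nat_add_iff' H).2 hu)
    ((hasSum_nat_add_iff' H).2 hw)).trans (sub_le_self W (Finset.sum_nonneg fun t _ => hw0 t))

theorem add_one_mul_pow_le_sqrt_pow_mul {γ : ℝ} (hγ0 : 0 ≤ γ) (hγ1 : γ < 1) {H t : ℕ}
    (hHt : H ≤ t) : (t + 1) * γ ^ t ≤ √γ ^ H * ((t + 1) * √γ ^ t) :=
  calc (t + 1) * γ ^ t = √γ ^ t * ((t + 1) * √γ ^ t) := by
        nth_rw 1 [← Real.mul_self_sqrt hγ0]; ring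
    _ ≤ √γ ^ H * ((t + 1) * √γ ^ t) := by
        gcongr ?_ * _
        exact pow_le_pow_of_le_one (Real.sqrt_nonneg γ) (sqrt_lt_one hγ1).le hHt

theorem sub_sum_range_le_sqrt_pow_mul {γ : ℝ} (hγ0 : 0 ≤ γ) (hγ1 : γ < 1) {u : ℕ → ℝ} {U : ℝ}
    (hu : HasSum u U) (hu_le : ∀ t, u t ≤ (t + 1) * γ ^ t) (H : ℕ) :
    U - ∑ t ∈ Finset.range H, u t ≤ √γ ^ H * (1 - √γ)⁻¹ ^ 2 :=
  sub_sum_range_le_of_le hu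
    ((hasSum_add_one_mul_pow (Real.sqrt_nonneg γ) (sqrt_lt_one hγ1)).mul_left (√γ ^ H))
    (fun t => by positivity)
    fun t ht => (hu_le t).trans (add_one_mul_pow_le_sqrt_pow_mul hγ0 hγ1 ht)

variable {m : ℕ} {Mg L γ g η ε δ v : ℝ}

theorem gradPrecision_pos (hη : 0 < η) (hε : 0 < ε) (hv : 0 < v) : 0 < gradPrecision m η ε v := by
  unfold gradPrecision; positivity

theorem valuePrecision_pos (hL : 0 ≤ L) (hη : 0 < η) (hε : 0 < ε) (hv : 0 < v) :
    0 < valuePrecision m L η ε v := by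
  unfold valuePrecision; positivity

theorem inv_valuePrecision_le (hL : 0 ≤ L) (hη : 0 < η) (hε : 0 < ε) (hv : 0 < v) :
    (valuePrecision m L η ε v)⁻¹ ≤ v / 2 := by
  rw [← inv_div]
  exact inv_anti₀ (by positivity) (le_add_of_nonneg_right (by positivity))

theorem inv_precisions_error_le (hL : 0 ≤ L) (hη : 0 < η) (hε : 0 < ε) (hv : 0 < v) :
    (gradPrecision m η ε v)⁻¹ + η * (m * (2 / v * (gradPrecision m η ε v)⁻¹ +
      2 / v ^ 2 * L * (valuePrecision m L η ε v)⁻¹)) ≤ ε := by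
  have hb := valuePrecision_pos (m := m) hL hη hε hv
  have h_grad : (gradPrecision m η ε v)⁻¹ * (1 + 2 * η * m / v) = ε / 2 := by
    unfold gradPrecision; field_simp
  have h_value : 4 * η * m * L / (ε * v ^ 2) * (valuePrecision m L η ε v)⁻¹ ≤ 1 := by
    rw [← div_eq_mul_inv, div_le_one hb]
    exact le_add_of_nonneg_left (by positivity)
  calc _ = (gradPrecision m η ε v)⁻¹ * (1 + 2 * η * m / v) +
        ε / 2 * (4 * η * m * L / (ε * v ^ 2) * (valuePrecision m L η ε v)⁻¹) := by
          field_simp; ring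
    _ ≤ ε / 2 + ε / 2 * 1 := by rw [h_grad]; gcongr
    _ = ε := by ring

theorem log_four_mul_add_one_div_nonneg (hδ : 0 < δ) (hδ1 : δ ≤ 1) :
    0 ≤ Real.log (4 * (m + 1) / δ) :=
  Real.log_nonneg ((one_le_div hδ).2 (by linarith [m.cast_nonneg (α := ℝ)]))

theorem batchSize_conditions_of_batchThreshold_le {n : ℕ} (hδ : 0 < δ) (hδ1 : δ ≤ 1)
    (hn : batchThreshold m Mg γ η ε δ v ≤ n) :
    64 * (Mg * (1 - γ)⁻¹ ^ 2 / (gradPrecision m η ε v)⁻¹) ^ 2 *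
        Real.log (2 / (δ / (2 * (m + 1)))) ≤ n ∧
      64 * ((1 - γ)⁻¹ / (valuePrecision m (Mg * (1 - γ)⁻¹ ^ 2) η ε v)⁻¹) ^ 2 *
        Real.log (2 / (δ / (2 * (m + 1)))) ≤ n := by
  have h_log := log_four_mul_add_one_div_nonneg (m := m) hδ hδ1
  rw [show 2 / (δ / (2 * (m + 1))) = 4 * (m + 1) / δ by field_simp; norm_num, div_inv_eq_mul,
    div_inv_eq_mul]
  constructor <;> refine le_trans ?_ (Nat.ceil_le.1 hn) <;> gcongr
  exacts [le_add_of_nonneg_right (sq_nonneg _), le_add_of_nonneg_left (sq_nonneg _)]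

theorem horizonFactor_pos (hMg : 0 < Mg) (hγ1 : γ < 1) (hη : 0 < η) (hε : 0 < ε) (hv : 0 < v) :
    0 < horizonFactor m Mg γ η ε v := by
  have ha := gradPrecision_pos (m := m) hη hε hv
  have hb := valuePrecision_pos (m := m) (L := Mg * (1 - γ)⁻¹ ^ 2) (by positivity) hη hε hv
  have hs : 0 < 1 - √γ := sub_pos.2 (sqrt_lt_one hγ1)
  unfold horizonFactor; positivity

theorem sqrt_pow_mul_horizonFactor_le_one {H : ℕ} (hMg : 0 < Mg) (hγ0 : 0 < γ) (hγ1 : γ < 1)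
    (hη : 0 < η) (hε : 0 < ε) (hv : 0 < v) (hH : horizonThreshold m Mg γ η ε v ≤ H) :
    √γ ^ H * horizonFactor m Mg γ η ε v ≤ 1 := by
  have hs : 0 < √γ := Real.sqrt_pos.2 hγ0
  have h := (Real.logb_le_iff_le_rpow ((one_lt_inv₀ hs).2 (sqrt_lt_one hγ1))
    (horizonFactor_pos hMg hγ1 hη hε hv)).1 (Nat.ceil_le.1 hH)
  rw [Real.rpow_natCast, inv_pow] at h
  exact (mul_le_mul_of_nonneg_left h (by positivity)).trans_eq (mul_inv_cancel₀ (by positivity))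

theorem horizon_conditions_of_horizonThreshold_le {H : ℕ} (hMg : 0 < Mg) (hγ0 : 0 < γ)
    (hγ1 : γ < 1) (hη : 0 < η) (hε : 0 < ε) (hv : 0 < v)
    (hH : horizonThreshold m Mg γ η ε v ≤ H) :
    Mg * (1 - γ)⁻¹ ^ 2 - ∑ t ∈ Finset.range H, Mg * ((t + 1) * γ ^ t) ≤
        (gradPrecision m η ε v)⁻¹ / 2 ∧
      (1 - γ)⁻¹ - ∑ t ∈ Finset.range H, γ ^ t ≤
        (valuePrecision m (Mg * (1 - γ)⁻¹ ^ 2) η ε v)⁻¹ / 2 := by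
  have h_grad_tail := sub_sum_range_le_sqrt_pow_mul hγ0.le hγ1 (hasSum_add_one_mul_pow hγ0.le hγ1)
    (fun _ => le_rfl) H
  have h_value_tail := sub_sum_range_le_sqrt_pow_mul hγ0.le hγ1
    (hasSum_geometric_of_lt_one hγ0.le hγ1)
    (fun t => le_mul_of_one_le_left (pow_nonneg hγ0.le t) (le_add_of_nonneg_left t.cast_nonneg)) H
  have h_factor := sqrt_pow_mul_horizonFactor_le_one hMg hγ0 hγ1 hη hε hv hH
  have ha := gradPrecision_pos (m := m) hη hε hv
  have hb := valuePrecision_pos (m := m) (L := Mg * (1 - γ)⁻¹ ^ 2) (by positivity) hη hε hv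
  unfold horizonFactor at h_factor
  set a := gradPrecision m η ε v
  set b := valuePrecision m (Mg * (1 - γ)⁻¹ ^ 2) η ε v
  set T := √γ ^ H * (1 - √γ)⁻¹ ^ 2
  have hT : 0 ≤ T := by positivity
  have h_sum : 2 * (Mg * T * a) + 2 * (T * b) ≤ 1 := h_factor.trans_eq' (by ring)
  have h_grad_nonneg : 0 ≤ Mg * T * a := by positivity
  have h_value_nonneg : 0 ≤ T * b := by positivity
  constructor
  · rw [← Finset.mul_sum, ← mul_sub]
    refine (mul_le_mul_of_nonneg_left h_grad_tail hMg.le).trans ?_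
    rw [le_div_iff₀ two_pos, ← one_div, le_div_iff₀ ha]
    linarith
  · refine h_value_tail.trans ?_
    rw [le_div_iff₀ two_pos, ← one_div, le_div_iff₀ hb]
    linarith

theorem natCast_ceil_le_add_mul {x y C c : ℝ} (hC : 0 ≤ C) (hy : 0 ≤ y) (hx : x ≤ C * y)
    (h_one : 1 ≤ c * y) : (⌈x⌉₊ : ℝ) ≤ (C + c) * y :=
  calc (⌈x⌉₊ : ℝ) ≤ ⌈C * y⌉₊ := by gcongr
    _ ≤ C * y + 1 := (Nat.ceil_lt_add_one (mul_nonneg hC hy)).le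
    _ ≤ (C + c) * y := by rw [add_mul]; gcongr

theorem log_le_mul_log_of_le_mul_pow {x c y y₀ : ℝ} {k : ℕ} (hx : 0 < x) (hxc : x ≤ c * y ^ k)
    (hy₀ : 1 < y₀) (hy : y₀ ≤ y) : Real.log x ≤ (|Real.log c| / Real.log y₀ + k) * Real.log y := by
  have hy_pos : 0 < y := by linarith
  have hc : 0 < c := pos_of_mul_pos_left (hx.trans_le hxc) (by positivity)
  have h_log_y₀ : 0 < Real.log y₀ := Real.log_pos hy₀
  have h_ratio : 1 ≤ Real.log y / Real.log y₀ :=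
    (one_le_div h_log_y₀).2 (Real.log_le_log (by linarith) hy)
  calc Real.log x ≤ Real.log (c * y ^ k) := Real.log_le_log hx hxc
    _ = Real.log c + k * Real.log y := by
        rw [Real.log_mul hc.ne' (by positivity), Real.log_pow]
    _ ≤ |Real.log c| * (Real.log y / Real.log y₀) + k * Real.log y := by
        gcongr
        exact (le_abs_self _).trans (le_mul_of_one_le_right (abs_nonneg _) h_ratio)
    _ = _ := by ring

section BatchOrder

variable {K : ℝ} (hg : 1 ≤ g) (hε : 0 < ε) (hεK : ε ≤ K * η) (hv : 0 < v) (hvg : v ≤ g)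
  (hvK : v ^ 2 ≤ K * η)

include hg hε hεK hv hvg in
theorem one_le_mul_pow_three_mul : 1 ≤ K * (g ^ 3 * (η / (ε * v ^ 2))) := by
  have hKη : 0 < K * η := hε.trans_le hεK
  calc (1 : ℝ) ≤ g := hg
    _ = ε * g * v ^ 2 / (ε * v ^ 2) := by field_simp
    _ ≤ K * η * g * g ^ 2 / (ε * v ^ 2) := by gcongr
    _ = _ := by ring

include hg hε hv hvg hvK in
theorem sq_mul_gradPrecision_le (hη : 0 < η) :
    g ^ 2 * gradPrecision m η ε v ≤ (2 * K + 4 * m) * (g ^ 3 * (η / (ε * v ^ 2))) := by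
  calc g ^ 2 * gradPrecision m η ε v =
        (2 * g ^ 2 * v ^ 2 + 4 * m * (g ^ 2 * η * v)) / (ε * v ^ 2) := by
          unfold gradPrecision; field_simp; ring
    _ ≤ (2 * g ^ 3 * (K * η) + 4 * m * (g ^ 2 * η * g)) / (ε * v ^ 2) := by
        gcongr
        norm_num
    _ = _ := by ring

include hg hε hεK hv hvg in
theorem mul_valuePrecision_le :
    g * valuePrecision m (Mg * g ^ 2) η ε v ≤
      (2 * K + 4 * m * Mg) * (g ^ 3 * (η / (ε * v ^ 2))) := by
  have hKη : 0 < K * η := hε.trans_le hεK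
  calc g * valuePrecision m (Mg * g ^ 2) η ε v =
        (2 * g * (ε * v) + 4 * m * Mg * (g ^ 3 * η)) / (ε * v ^ 2) := by
          unfold valuePrecision; field_simp
    _ ≤ (2 * g ^ 2 * (K * η * g) + 4 * m * Mg * (g ^ 3 * η)) / (ε * v ^ 2) := by
        gcongr
        exact le_self_pow₀ hg two_ne_zero
    _ = _ := by ring

include hg hε hεK hv hvg hvK in
theorem sq_precisions_add_le (hMg : 0 ≤ Mg) (hη : 0 < η) :
    (Mg * g ^ 2 * gradPrecision m η ε v) ^ 2 + (g * valuePrecision m (Mg * g ^ 2) η ε v) ^ 2 ≤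
      ((Mg * (2 * K + 4 * m)) ^ 2 + (2 * K + 4 * m * Mg) ^ 2) *
        (g ^ 3 * (η / (ε * v ^ 2))) ^ 2 := by
  have ha := gradPrecision_pos (m := m) hη hε hv
  have hb := valuePrecision_pos (m := m) (L := Mg * g ^ 2) (by positivity) hη hε hv
  rw [add_mul, ← mul_pow, ← mul_pow, mul_assoc Mg, mul_assoc Mg]
  gcongr ?_ ^ 2 + ?_ ^ 2
  · exact mul_le_mul_of_nonneg_left (sq_mul_gradPrecision_le hg hε hv hvg hvK hη) hMg
  · exact mul_valuePrecision_le hg hε hεK hv hvg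

end BatchOrder

theorem batchThreshold_order (hMg : 0 < Mg) (K δ₀ : ℝ) (hδ₀ : δ₀ < 1) :
    ∃ C : ℝ, ∀ γ η ε δ v : ℝ, 0 < γ → γ < 1 → 0 < η →
      0 < ε → ε ≤ K * η → 0 < δ → δ ≤ δ₀ → 0 < v → v ≤ 1 / (1 - γ) → v ^ 2 ≤ K * η →
        (batchThreshold m Mg γ η ε δ v : ℝ) ≤
          C * (ε⁻¹ ^ 2 * (1 - γ)⁻¹ ^ 6 * v⁻¹ ^ 4 * η ^ 2 * Real.log (1 / δ)) := by
  set c := (Mg * (2 * K + 4 * m)) ^ 2 + (2 * K + 4 * m * Mg) ^ 2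
  set cl := |Real.log (4 * (m + 1))| / Real.log (1 / δ₀) + (1 : ℕ)
  refine ⟨64 * c * cl + K ^ 2 / Real.log (1 / δ₀), ?_⟩
  intro γ η ε δ v hγ0 hγ1 hη hε hεK hδ hδδ₀ hv hvγ hvK
  have hK : 0 < K := pos_of_mul_pos_left (hε.trans_le hεK) hη.le
  have hg : 1 ≤ (1 - γ)⁻¹ := (one_le_inv₀ (sub_pos.2 hγ1)).2 (by linarith)
  rw [one_div] at hvγ
  set g := (1 - γ)⁻¹
  set Q := g ^ 3 * (η / (ε * v ^ 2)) with hQ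
  have hδ₀_inv : 1 < 1 / δ₀ := (one_lt_div (hδ.trans_le hδδ₀)).2 hδ₀
  have h_inv : 1 / δ₀ ≤ 1 / δ := one_div_le_one_div_of_le hδ hδδ₀
  have h_log_pos : 0 < Real.log (1 / δ₀) := Real.log_pos hδ₀_inv
  have h_log_le : Real.log (1 / δ₀) ≤ Real.log (1 / δ) := Real.log_le_log (by positivity) h_inv
  have h_log : Real.log (4 * (m + 1) / δ) ≤ cl * Real.log (1 / δ) :=
    log_le_mul_log_of_le_mul_pow (by positivity) (by rw [pow_one, mul_one_div]) hδ₀_inv h_inv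
  have h_log_nonneg : 0 ≤ Real.log (1 / δ) := h_log_pos.le.trans h_log_le
  have h_one : 1 ≤ K ^ 2 / Real.log (1 / δ₀) * (Q ^ 2 * Real.log (1 / δ)) :=
    calc 1 ≤ (K * Q) ^ 2 * (Real.log (1 / δ) / Real.log (1 / δ₀)) :=
          one_le_mul_of_one_le_of_one_le
            (one_le_pow₀ (one_le_mul_pow_three_mul hg hε hεK hv hvγ))
            ((one_le_div h_log_pos).2 h_log_le)
      _ = _ := by ring
  rw [show ε⁻¹ ^ 2 * g ^ 6 * v⁻¹ ^ 4 * η ^ 2 = Q ^ 2 by rw [hQ]; field_simp]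
  refine natCast_ceil_le_add_mul (by positivity) (by positivity) ?_ h_one
  have h_log_four := log_four_mul_add_one_div_nonneg (m := m) hδ (hδδ₀.trans hδ₀.le)
  calc _ ≤ 64 * (c * Q ^ 2) * (cl * Real.log (1 / δ)) := by
        gcongr
        exact sq_precisions_add_le hg hε hεK hv hvγ hvK hMg.le hη
    _ = _ := by ring

theorem exists_horizonFactor_le_mul_sq (hMg : 0 < Mg) (γ K : ℝ) :
    ∃ c : ℝ, ∀ η ε v : ℝ, 0 < η → η ≤ K → 0 < ε → ε ≤ K → 0 < v → v ≤ (1 - γ)⁻¹ →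
      horizonFactor m Mg γ η ε v ≤ c * (1 / (ε * v)) ^ 2 := by
  set g := (1 - γ)⁻¹
  refine ⟨2 * (Mg * (2 * K * g ^ 2 + 4 * m * K ^ 2 * g) +
    (2 * K ^ 2 * g + 4 * m * (Mg * g ^ 2) * K ^ 2)) * (1 - √γ)⁻¹ ^ 2, ?_⟩
  intro η ε v hη hηK hε hεK hv hvg
  have hK : 0 < K := hη.trans_le hηK
  have h_grad : gradPrecision m η ε v ≤
      (2 * K * g ^ 2 + 4 * m * K ^ 2 * g) * (1 / (ε * v)) ^ 2 :=
    calc gradPrecision m η ε v =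
          (2 * ε * v ^ 2 + 4 * m * (η * ε) * v) * (1 / (ε * v)) ^ 2 := by
            unfold gradPrecision; field_simp; ring
      _ ≤ (2 * K * g ^ 2 + 4 * m * (K * K) * g) * (1 / (ε * v)) ^ 2 := by gcongr
      _ = _ := by ring
  have h_value : valuePrecision m (Mg * g ^ 2) η ε v ≤
      (2 * K ^ 2 * g + 4 * m * (Mg * g ^ 2) * K ^ 2) * (1 / (ε * v)) ^ 2 :=
    calc valuePrecision m (Mg * g ^ 2) η ε v =
          (2 * ε ^ 2 * v + 4 * m * (Mg * g ^ 2) * (η * ε)) * (1 / (ε * v)) ^ 2 := by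
            unfold valuePrecision; field_simp
      _ ≤ (2 * K ^ 2 * g + 4 * m * (Mg * g ^ 2) * (K * K)) * (1 / (ε * v)) ^ 2 := by gcongr
      _ = _ := by ring
  calc horizonFactor m Mg γ η ε v ≤
        2 * (Mg * ((2 * K * g ^ 2 + 4 * m * K ^ 2 * g) * (1 / (ε * v)) ^ 2) +
          (2 * K ^ 2 * g + 4 * m * (Mg * g ^ 2) * K ^ 2) * (1 / (ε * v)) ^ 2) *
            (1 - √γ)⁻¹ ^ 2 := by unfold horizonFactor; gcongr
    _ = _ := by ring

theorem horizonThreshold_order (hMg : 0 < Mg) (γ K q : ℝ) (hγ0 : 0 < γ) (hγ1 : γ < 1)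
    (hq : q < 1) :
    ∃ C : ℝ, ∀ η ε v : ℝ, 0 < η → η ≤ K → 0 < ε → ε ≤ K → 0 < v → v ≤ 1 / (1 - γ) → ε * v ≤ q →
      (horizonThreshold m Mg γ η ε v : ℝ) ≤ C * Real.log (1 / (ε * v)) := by
  obtain ⟨c, hc⟩ := exists_horizonFactor_le_mul_sq (m := m) hMg γ K
  have h_log_sqrt : 0 < Real.log (√γ)⁻¹ :=
    Real.log_pos ((one_lt_inv₀ (Real.sqrt_pos.2 hγ0)).2 (sqrt_lt_one hγ1))
  refine ⟨(|Real.log c| / Real.log (1 / q) + (2 : ℕ)) / Real.log (√γ)⁻¹ +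
    1 / Real.log (1 / q), ?_⟩
  intro η ε v hη hηK hε hεK hv hvγ hεvq
  have hεv : 0 < ε * v := mul_pos hε hv
  have hq_inv : 1 < 1 / q := (one_lt_div (hεv.trans_le hεvq)).2 hq
  have h_inv : 1 / q ≤ 1 / (ε * v) := one_div_le_one_div_of_le hεv hεvq
  have h_log_pos : 0 < Real.log (1 / q) := Real.log_pos hq_inv
  have h_log_le : Real.log (1 / q) ≤ Real.log (1 / (ε * v)) :=
    Real.log_le_log (by linarith) h_inv
  have h_log := log_le_mul_log_of_le_mul_pow (horizonFactor_pos hMg hγ1 hη hε hv)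
    (hc η ε v hη hηK hε hεK hv (hvγ.trans_eq (one_div _))) hq_inv h_inv
  refine natCast_ceil_le_add_mul (by positivity) (by linarith) ?_ ?_
  · rw [div_mul_eq_mul_div]
    exact div_le_div_of_nonneg_right h_log h_log_sqrt.le
  · rw [div_mul_eq_mul_div, one_mul, one_le_div h_log_pos]
    exact h_log_le

end Thresholds

end

section PlugIn

open Filter Topology

theorem CMDP.one_sub_le_measureReal_norm_logBarrierGradEst_sub_le {S A : Type*}
    [MeasurableSpace S] [MeasurableSpace A] {m d : ℕ} (hm : 1 ≤ m) (M : CMDP S A m)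
    {π : PolicyFamily S A d} {Mg : ℝ} (hMg : 0 < Mg) (hπ : ∀ x, Differentiable ℝ (π.logDens x))
    {θ : EuclideanSpace ℝ (Fin d)} (h_score : ∀ᶠ θ' in 𝓝 θ, ∀ x, ‖π.score x θ'‖ ≤ Mg)
    (h_pos : ∀ i : Fin m, 0 < M.value π i.succ θ) {η ε δ : ℝ} (hη : 0 < η) (hε : 0 < ε)
    (hδ : 0 < δ) (hδ1 : δ ≤ 1) {n H : ℕ}
    (hn : batchThreshold m Mg M.γ η ε δ (M.minValue π θ) ≤ n)
    (hH : horizonThreshold m Mg M.γ η ε (M.minValue π θ) ≤ H) :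
    1 - δ ≤ (M.batchLaw π θ n).real
      {ω | ‖M.logBarrierGradEst π η θ H ω - gradient (M.logBarrier π η) θ‖ ≤ ε} := by
  have hv := M.minValue_pos π hm h_pos
  obtain ⟨hγ0, hγ1⟩ := M.γ_mem
  have hL : 0 ≤ Mg * (1 - M.γ)⁻¹ ^ 2 := by positivity
  have h_score_θ := h_score.self_of_nhds
  obtain ⟨hn_grad, hn_value⟩ := batchSize_conditions_of_batchThreshold_le hδ hδ1 hn
  obtain ⟨hH_grad, hH_value⟩ := horizon_conditions_of_horizonThreshold_le hMg hγ0 hγ1 hη hε hv hH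
  have h_estimators := M.one_sub_le_measureReal_norm_estimators_sub_le (fun x => hπ x θ) hMg
    h_score_θ (inv_pos.2 (gradPrecision_pos hη hε hv)) (inv_pos.2 (valuePrecision_pos hL hη hε hv))
    (by positivity) hn_grad hn_value hH_grad hH_value
  rw [mul_div_cancel₀ δ (by positivity)] at h_estimators
  have : IsProbabilityMeasure (M.batchLaw π θ n) := by unfold CMDP.batchLaw; infer_instance
  refine h_estimators.trans (measureReal_mono fun ω hω => ?_)
  rw [Set.mem_ofPred_eq, (M.hasGradientAt_logBarrier hπ hMg.le h_score h_pos η).gradient]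
  refine (norm_add_smul_sum_inv_smul_sub_le hv hη.le (M.minValue_le π θ)
    (fun i => (hω i.succ).2) (inv_valuePrecision_le hL hη hε hv)
    (fun i => M.norm_valueGrad_le h_score_θ i.succ) (hω 0).1 fun i => (hω i.succ).1).trans ?_
  rw [Fintype.card_fin]
  exact inv_precisions_error_le hL hη hε hv

end PlugIn

theorem mainTheorem6_general (m : ℕ) (hm : 1 ≤ m) (Mg : ℝ) (hMg : 0 < Mg) :
    ∃ (n₀ : ℝ → ℝ → ℝ → ℝ → ℝ → ℕ) (H₀ : ℝ → ℝ → ℝ → ℝ → ℕ),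
      (∀ (S : Type*) (A : Type*) [MeasurableSpace S] [MeasurableSpace A] (d : ℕ)
        (M : CMDP S A m) (π : PolicyFamily S A d), (∀ x, Differentiable ℝ (π.logDens x)) →
        (∀ θ ∈ M.feasible π, ∀ x, ‖π.score x θ‖ ≤ Mg) →
        ∀ θ : EuclideanSpace ℝ (Fin d), (∀ i : Fin m, 0 < M.value π i.succ θ) →
        ∀ η ε δ : ℝ, 0 < η → 0 < ε → 0 < δ → δ ≤ 1 →
          DifferentiableAt ℝ (M.logBarrier π η) θ ∧
          ∀ n H : ℕ, n₀ M.γ η ε δ (M.minValue π θ) ≤ n → H₀ M.γ η ε (M.minValue π θ) ≤ H →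
            1 - δ ≤ (M.batchLaw π θ n).real
              {ω | ‖M.logBarrierGradEst π η θ H ω - gradient (M.logBarrier π η) θ‖ ≤ ε}) ∧
      (∀ K δ₀ : ℝ, δ₀ < 1 → ∃ C : ℝ, ∀ γ η ε δ v : ℝ, 0 < γ → γ < 1 → 0 < η →
        0 < ε → ε ≤ K * η → 0 < δ → δ ≤ δ₀ → 0 < v → v ≤ 1 / (1 - γ) → v ^ 2 ≤ K * η →
          (n₀ γ η ε δ v : ℝ) ≤
            C * (ε⁻¹ ^ 2 * (1 - γ)⁻¹ ^ 6 * v⁻¹ ^ 4 * η ^ 2 * Real.log (1 / δ))) ∧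
      (∀ γ K q : ℝ, 0 < γ → γ < 1 → q < 1 → ∃ C : ℝ, ∀ η ε v : ℝ, 0 < η → η ≤ K →
        0 < ε → ε ≤ K → 0 < v → v ≤ 1 / (1 - γ) → ε * v ≤ q →
          (H₀ γ η ε v : ℝ) ≤ C * Real.log (1 / (ε * v))) := by
  refine ⟨batchThreshold m Mg, horizonThreshold m Mg, ?_, batchThreshold_order hMg,
    horizonThreshold_order hMg⟩
  intro S A _ _ d M π hπ h_score θ h_pos η ε δ hη hε hδ hδ1
  have h_score_near := M.eventually_score_le (fun x => (hπ x).continuous) h_score h_pos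
  exact ⟨(M.hasGradientAt_logBarrier hπ hMg.le h_score_near h_pos η).differentiableAt,
    fun n H hn hH => M.one_sub_le_measureReal_norm_logBarrierGradEst_sub_le hm hMg hπ h_score_near
      h_pos hη hε hδ hδ1 hn hH⟩

theorem mainTheorem6 (m : ℕ) (hm : 1 ≤ m) (Mg : ℝ) (hMg : 0 < Mg) :
    -- batch-size threshold `n₀ γ η ε δ v` and horizon threshold `H₀ γ η ε v`
    ∃ (n₀ : ℝ → ℝ → ℝ → ℝ → ℝ → ℕ) (H₀ : ℝ → ℝ → ℝ → ℝ → ℕ),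
      -- the thresholds suffice
      (∀ (S : Type*) (A : Type*) [MeasurableSpace S] [MeasurableSpace A] (d : ℕ)
        (M : CMDP S A m) (π : PolicyFamily S A d) (Mh : ℝ), 0 < Mh → M.BoundedScore π Mg Mh →
        ∀ θ : EuclideanSpace ℝ (Fin d), (∀ i : Fin m, 0 < M.value π i.succ θ) →
        ∀ η ε δ : ℝ, 0 < η → 0 < ε → 0 < δ → δ ≤ 1 →
          DifferentiableAt ℝ (M.logBarrier π η) θ ∧
          ∀ n H : ℕ, n₀ M.γ η ε δ (M.minValue π θ) ≤ n → H₀ M.γ η ε (M.minValue π θ) ≤ H →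
            1 - δ ≤ (M.batchLaw π θ n).real
              {ω | ‖M.logBarrierGradEst π η θ H ω - gradient (M.logBarrier π η) θ‖ ≤ ε}) ∧
      -- order of the batch size
      (∀ K δ₀ : ℝ, δ₀ < 1 → ∃ C : ℝ, ∀ γ η ε δ v : ℝ, 0 < γ → γ < 1 → 0 < η →
        0 < ε → ε ≤ K * η → 0 < δ → δ ≤ δ₀ → 0 < v → v ≤ 1 / (1 - γ) → v ^ 2 ≤ K * η →
          (n₀ γ η ε δ v : ℝ) ≤
            C * (ε⁻¹ ^ 2 * (1 - γ)⁻¹ ^ 6 * v⁻¹ ^ 4 * η ^ 2 * Real.log (1 / δ))) ∧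
      -- order of the horizon
      (∀ γ K q : ℝ, 0 < γ → γ < 1 → q < 1 → ∃ C : ℝ, ∀ η ε v : ℝ, 0 < η → η ≤ K →
        0 < ε → ε ≤ K → 0 < v → v ≤ 1 / (1 - γ) → ε * v ≤ q →
          (H₀ γ η ε v : ℝ) ≤ C * Real.log (1 / (ε * v))) := by
  obtain ⟨n₀, H₀, h, h_orders⟩ := mainTheorem6_general m hm Mg hMg
  exact ⟨n₀, H₀, fun S A _ _ d M π Mh _ hB => h S A d M π hB.1 fun θ hθ x => (hB.2.2 θ hθ x).1,
    h_orders⟩
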